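/- Let $\mathbb K$ be $\mathbb R$ or $\mathbb C$ and let $(Y,\|\cdot\|)$ be a Banach space over $\mathbb K$. Then there is a norm $p$ on $Y$ equivalent to $\|\cdot\|$ (that is, $c\|x\|\le p(x)\le C\|x\|$ for all $x\in Y$, with some constants $c,C>0$) such that the group $\operatorname{Iso}(Y,p)$ of all surjective linear isometries of $(Y,p)$ is topologically reflexive. Here a set $\mathscr S$ of continuous linear operators on $Y$ is called topologically reflexive if every continuous linear operator $T$ on $Y$ satisfying $$Tx\in\overline{\{Lx : L\in\mathscr S\}}\qquad\text{for every } x\in Y$$ belongs to $\mathscr S$. -/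

import Mathlib

/-- The topological reflexive hull of a set `S` of continuous linear operators on a topological
vector space `X`: the continuous linear operators `T` such that, for every `x`, the vector `T x`
lies in the closure of the orbit `S x = {L x : L ∈ S}`. -/
def topReflexiveHull {𝕜 X : Type*} [Semiring 𝕜] [AddCommMonoid X] [Module 𝕜 X]
    [TopologicalSpace X] (S : Set (X →L[𝕜] X)) : Set (X →L[𝕜] X) :=
  {T | ∀ x : X, T x ∈ closure ((fun L : X →L[𝕜] X => L x) '' S)}

/-- A set of continuous linear operators is topologically reflexive if it coincides with its
topological reflexive hull. -/
def IsTopologicallyReflexive {𝕜 X : Type*} [Semiring 𝕜] [AddCommMonoid X] [Module 𝕜 X]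
    [TopologicalSpace X] (S : Set (X →L[𝕜] X)) : Prop :=
  topReflexiveHull S = S

/-- `p` is an equivalent norm (a renorming) on the normed space `X`. The lower bound makes the
seminorm `p` a norm; the two bounds together say that `p` and `‖·‖` are equivalent, so they
induce the same topology and have the same continuous linear operators. -/
def IsEquivalentNorm {𝕜 X : Type*} [RCLike 𝕜] [NormedAddCommGroup X] [NormedSpace 𝕜 X]
    (p : Seminorm 𝕜 X) : Prop :=
  ∃ c C : ℝ, 0 < c ∧ 0 < C ∧ ∀ x : X, c * ‖x‖ ≤ p x ∧ p x ≤ C * ‖x‖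

/-- The set (in fact a group under composition) of all surjective linear isometries of `(X, p)`,
as continuous linear operators on `X`. For an equivalent norm `p`, continuity with respect to
`‖·‖` is no restriction. -/
def isometryGroupOf {𝕜 X : Type*} [RCLike 𝕜] [NormedAddCommGroup X] [NormedSpace 𝕜 X]
    (p : Seminorm 𝕜 X) : Set (X →L[𝕜] X) :=
  {L | Function.Surjective L ∧ ∀ x : X, p (L x) = p x}

open Set Filter Topology

/-! In finite dimension an operator in the hull is isometric, hence injective, hence onto. In
infinite dimension the norm is built to have very few isometries. Zorn's lemma gives a maximal
biorthogonal system; a pair `(e, f₀)` and a two-dimensional Euclidean block are set apart, and the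
rest is indexed by `I`, to be well-ordered. The norm is the supremum of a multiple of a base norm,
one `spike i` per apex `y i = e + x i`, and the moduli of the functionals `u₂ i k` for `i < k`.

Near `y i` only `spike i` counts, so the norm has a kink there. Small moves along the Euclidean
block show that no kink lies off the lines through the apexes (`exists_eq_smul_y_of_isKink`), so a
surjective isometry permutes these lines. The dominating weight of `o` fixes one line, invariance of
`u o` makes the scalar common to all apexes, the `u₂ i k` make the permutation monotone, and a
well-order has no automorphism but the identity. Hence there is a unimodular `a` with `L (y i) = a •
y i` and `u i ∘ L = a * u i` (`exists_scalar_of_mem_isometryGroupOf`).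

Both relations pass to an operator `T` of the hull. So `T - a` vanishes on the closed span of the
apexes and, by maximality of the system, maps a subspace of finite codimension into that span plus a
finite-dimensional space. As `T` is injective, a Fredholm-type argument makes it onto. -/

/-- A biorthogonal system in `Y`, indexed by `I` together with one extra pair `(e, f₀)` and a
two-dimensional Euclidean block `j`, `g`, with weights `w` and a distinguished index `o`. -/
structure WeightedFrame (𝕜 Y I : Type*) [RCLike 𝕜] [NormedAddCommGroup Y] [NormedSpace 𝕜 Y] where
  e : Y
  f₀ : Y →L[𝕜] 𝕜
  x : I → Y
  f : I → Y →L[𝕜] 𝕜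
  j : EuclideanSpace 𝕜 (Fin 2) →L[𝕜] Y
  g : Y →L[𝕜] EuclideanSpace 𝕜 (Fin 2)
  w : I → ℝ
  o : I
  f₀_e : f₀ e = 1
  f₀_x : ∀ i, f₀ (x i) = 0
  f₀_j : ∀ a, f₀ (j a) = 0
  f_e : ∀ i, f i e = 0
  f_x : ∀ i, f i (x i) = 1
  f_x_of_ne : ∀ {i k}, i ≠ k → f i (x k) = 0
  f_j : ∀ i a, f i (j a) = 0
  g_e : g e = 0
  g_x : ∀ i, g (x i) = 0
  g_j : ∀ a, g (j a) = a
  norm_x : ∀ i, ‖x i‖ = 1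
  w_pos : ∀ i, 0 < w i
  w_mul_le : ∀ i, w i * (1 + ‖f i‖) ≤ 1
  -- The factor is `bound / scale`, the loss incurred when kink strengths at `o` and `i` are
  -- compared through the base norm.
  w_mul_lt : ∀ i, i ≠ o → w i * ((2 + ‖f₀‖ * (‖e‖ + 2)) * (1 + ‖e‖)) < w o

/-! ### Building blocks and the new norm -/

namespace WeightedFrame

variable {𝕜 Y I : Type*} [RCLike 𝕜] [NormedAddCommGroup Y] [NormedSpace 𝕜 Y]
variable (F : WeightedFrame 𝕜 Y I)

/-- The constant bounding every building block of the norm. -/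
noncomputable def bound : ℝ := 2 + ‖F.f₀‖ * (‖F.e‖ + 2)

/-- The seminorm of the component along the kernel of `g`. -/
noncomputable def kerSeminorm : Seminorm 𝕜 Y :=
  (normSeminorm 𝕜 Y).comp (LinearMap.id - (F.j.comp F.g : Y →L[𝕜] Y).toLinearMap)

/-- The base norm: the maximum of the norms of the two components. -/
noncomputable def base : Seminorm 𝕜 Y :=
  F.kerSeminorm ⊔ (normSeminorm 𝕜 _).comp F.g.toLinearMap

lemma kerSeminorm_apply (z : Y) : F.kerSeminorm z = ‖z - F.j (F.g z)‖ := rfl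

lemma base_apply (z : Y) : F.base z = max ‖z - F.j (F.g z)‖ ‖F.g z‖ := rfl

lemma kerSeminorm_le_base (z : Y) : F.kerSeminorm z ≤ F.base z := le_max_left _ _

lemma norm_g_le_base (z : Y) : ‖F.g z‖ ≤ F.base z := le_max_right _ _

lemma kerSeminorm_add_j (z : Y) (b) : F.kerSeminorm (z + F.j b) = F.kerSeminorm z := by
  simp only [kerSeminorm_apply, map_add, F.g_j]; congr 1; abel

lemma base_add_j (z : Y) (b) : F.base (z + F.j b) = max (F.kerSeminorm z) ‖F.g z + b‖ := by
  rw [← F.kerSeminorm_add_j z b, base_apply, kerSeminorm_apply, map_add, F.g_j]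

lemma base_of_g_eq_zero {z : Y} (h : F.g z = 0) : F.base z = ‖z‖ := by
  simp [base_apply, h]

lemma norm_le_base (z : Y) : ‖z‖ ≤ (1 + ‖F.j‖) * F.base z := by
  have h1 : ‖z‖ ≤ ‖z - F.j (F.g z)‖ + ‖F.j (F.g z)‖ := by
    simpa using norm_add_le (z - F.j (F.g z)) (F.j (F.g z))
  have h2 := F.j.le_opNorm (F.g z)
  have h3 := F.kerSeminorm_le_base z
  rw [kerSeminorm_apply] at h3
  have h4 := mul_le_mul_of_nonneg_left (F.norm_g_le_base z) (norm_nonneg F.j)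
  linarith

lemma base_le_norm (z : Y) : F.base z ≤ (1 + ‖F.j‖ * ‖F.g‖ + ‖F.g‖) * ‖z‖ := by
  have h2 := F.j.le_opNorm (F.g z)
  have h3 := F.g.le_opNorm z
  have h4 := mul_le_mul_of_nonneg_left h3 (norm_nonneg F.j)
  have h5 := norm_sub_le z (F.j (F.g z))
  have h6 : 0 ≤ ‖F.j‖ * ‖F.g‖ * ‖z‖ := by positivity
  have h7 : 0 ≤ ‖F.g‖ * ‖z‖ := by positivity
  rw [base_apply]
  apply max_le <;> nlinarith [norm_nonneg z]

lemma norm_apply_le {φ : Y →L[𝕜] 𝕜} (h : ∀ a, φ (F.j a) = 0) (z : Y) :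
    ‖φ z‖ ≤ ‖φ‖ * F.kerSeminorm z := by
  have : φ z = φ (z - F.j (F.g z)) := by simp [h]
  rw [this, kerSeminorm_apply]
  exact φ.le_opNorm _

/-- The apex vectors. -/
def y (i : I) : Y := F.e + F.x i

lemma f₀_y (i : I) : F.f₀ (F.y i) = 1 := by simp [y, F.f₀_e, F.f₀_x]

lemma f_y (i : I) : F.f i (F.y i) = 1 := by simp [y, F.f_e, F.f_x]

lemma f_y_of_ne {i k : I} (h : i ≠ k) : F.f i (F.y k) = 0 := by
  simp [y, F.f_e, F.f_x_of_ne h]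

lemma g_y (i : I) : F.g (F.y i) = 0 := by simp [y, F.g_e, F.g_x]

lemma base_y_le (i : I) : F.base (F.y i) ≤ ‖F.e‖ + 1 := by
  rw [F.base_of_g_eq_zero (F.g_y i), y, ← F.norm_x i]
  exact norm_add_le _ _

lemma base_y_sub_le (i k : I) : F.base (F.y i - F.y k) ≤ 2 := by
  rw [F.base_of_g_eq_zero (by simp [F.g_y])]
  calc _ = ‖F.x i - F.x k‖ := by simp [y]
    _ ≤ _ := (norm_sub_le _ _).trans (by rw [F.norm_x, F.norm_x]; norm_num)

/-- Subtraction of the component along the apex vector `y i`. -/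
noncomputable def proj (i : I) : Y →ₗ[𝕜] Y :=
  LinearMap.id - (F.f₀.smulRight (F.y i) : Y →L[𝕜] Y).toLinearMap

lemma proj_apply (i : I) (z : Y) : F.proj i z = z - F.f₀ z • F.y i := rfl

lemma proj_y_self (i : I) : F.proj i (F.y i) = 0 := by simp [proj_apply, F.f₀_y]

lemma g_proj (i : I) (z : Y) : F.g (F.proj i z) = F.g z := by simp [proj_apply, F.g_y]

lemma proj_add_j (i : I) (z : Y) (b) : F.proj i (z + F.j b) = F.proj i z + F.j b := by
  simp only [proj_apply, map_add, F.f₀_j, zero_smul]; abel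

/-- The functional supporting the norm at the apex `y i`. -/
noncomputable def u (i : I) : Y →L[𝕜] 𝕜 :=
  -- With 3/4, `u i` exceeds 1 at `y i`, is below 1 at every other apex, and stays below 3 at `y i +
  -- 2 • y k`, with room for the base term of the spike.
  F.f₀ + (F.w i : 𝕜) • (F.f i - ((3 / 4 : ℝ) : 𝕜) • F.f₀)

/-- The functional recording the relation `i < k`. -/
noncomputable def u₂ (i k : I) : Y →L[𝕜] 𝕜 :=
  -- At `y i + 2 • y k` the bracket is `1 + 4 - 9/2 = 1/2`; with `i` and `k` exchanged in the vector
  -- it is `-1/2`. This asymmetry encodes the order.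
  F.f₀ + ((F.w i * F.w k / 4 : ℝ) : 𝕜) • (F.f i + (2 : ℝ) • F.f k - ((3 / 2 : ℝ) : 𝕜) • F.f₀)

lemma u_apply (i : I) {z : Y} {a b : ℝ} (ha : F.f₀ z = a) (hb : F.f i z = b) :
    F.u i z = ((a + F.w i * (b - 3 / 4 * a) : ℝ) : 𝕜) := by
  simp [u, ha, hb]

lemma u₂_apply (i k : I) {z : Y} {a b c : ℝ} (ha : F.f₀ z = a) (hb : F.f i z = b)
    (hc : F.f k z = c) :
    F.u₂ i k z = ((a + F.w i * F.w k / 4 * (b + 2 * c - 3 / 2 * a) : ℝ) : 𝕜) := by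
  simp [u₂, ha, hb, hc, RCLike.real_smul_eq_coe_mul]

lemma u_j (i : I) (b) : F.u i (F.j b) = 0 := by simp [u, F.f₀_j, F.f_j]

lemma u₂_j (i k : I) (b) : F.u₂ i k (F.j b) = 0 := by simp [u₂, F.f₀_j, F.f_j]

lemma w_le_one (i : I) : F.w i ≤ 1 := by
  nlinarith [F.w_mul_le i, F.w_pos i, norm_nonneg (F.f i), mul_nonneg (F.w_pos i).le (norm_nonneg (F.f i))]

lemma w_mul_norm_le (i : I) : F.w i * ‖F.f i‖ ≤ 1 := by
  nlinarith [F.w_mul_le i, F.w_pos i]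

/-- The seminorm that has a kink along the line spanned by `y i`. -/
noncomputable def spike (i : I) : Seminorm 𝕜 Y :=
  (normSeminorm 𝕜 𝕜).comp (F.u i).toLinearMap +
    (F.w i / 24).toNNReal • F.base.comp (F.proj i)

lemma spike_apply (i : I) (z : Y) :
    F.spike i z = ‖F.u i z‖ + F.w i / 24 * F.base (F.proj i z) := by
  have : ((F.w i / 24).toNNReal : ℝ) = F.w i / 24 :=
    Real.coe_toNNReal _ (div_nonneg (F.w_pos i).le (by norm_num))
  rw [← this]; rfl

lemma norm_u_le (i : I) (z : Y) : ‖F.u i z‖ ≤ (‖F.f₀‖ + 1) * F.base z := by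
  have h0 := F.norm_apply_le F.f₀_j z
  have h1 := F.norm_apply_le (F.f_j i) z
  have h2 := F.kerSeminorm_le_base z
  have hn : 0 ≤ F.kerSeminorm z := apply_nonneg _ _
  have e1 : F.u i z = ((1 - 3 / 4 * F.w i : ℝ) : 𝕜) * F.f₀ z + (F.w i : 𝕜) * F.f i z := by
    simp [u]; ring
  have hw := F.w_le_one i
  have hw0 := F.w_pos i
  have e2 : ‖F.u i z‖ ≤ (1 - 3 / 4 * F.w i) * ‖F.f₀ z‖ + F.w i * ‖F.f i z‖ := by
    rw [e1]
    refine (norm_add_le _ _).trans_eq ?_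
    rw [norm_mul, norm_mul, RCLike.norm_ofReal, RCLike.norm_ofReal, abs_of_pos hw0,
      abs_of_nonneg (by linarith)]
  have e3 : (1 - 3 / 4 * F.w i) * ‖F.f₀ z‖ ≤ ‖F.f₀ z‖ := by
    nlinarith [norm_nonneg (F.f₀ z), mul_nonneg hw0.le (norm_nonneg (F.f₀ z))]
  have e4 := mul_le_mul_of_nonneg_left h1 hw0.le
  have e5 := mul_le_mul_of_nonneg_right (F.w_mul_norm_le i) hn
  have e6 := mul_le_mul_of_nonneg_left h2 (by positivity : 0 ≤ ‖F.f₀‖ + 1)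
  linarith

lemma norm_u₂_le (i k : I) (z : Y) : ‖F.u₂ i k z‖ ≤ (‖F.f₀‖ + 1) * F.base z := by
  have h0 := F.norm_apply_le F.f₀_j z
  have h1 := F.norm_apply_le (F.f_j i) z
  have h1' := F.norm_apply_le (F.f_j k) z
  have h2 := F.kerSeminorm_le_base z
  have hn : 0 ≤ F.kerSeminorm z := apply_nonneg _ _
  have hi := F.w_le_one i
  have hi0 := F.w_pos i
  have hk := F.w_le_one k
  have hk0 := F.w_pos k
  have hm0 : 0 < F.w i * F.w k := mul_pos hi0 hk0
  have hmi : F.w i * F.w k ≤ F.w i := mul_le_of_le_one_right hi0.le hk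
  have hmk : F.w i * F.w k ≤ F.w k := mul_le_of_le_one_left hk0.le hi
  have e1 : F.u₂ i k z = ((1 - 3 / 8 * (F.w i * F.w k) : ℝ) : 𝕜) * F.f₀ z +
      ((F.w i * F.w k / 4 : ℝ) : 𝕜) * F.f i z + ((F.w i * F.w k / 2 : ℝ) : 𝕜) * F.f k z := by
    simp only [u₂, add_apply, smul_apply, sub_apply,
      smul_eq_mul, RCLike.real_smul_eq_coe_mul]
    push_cast; ring
  have e2 : ‖F.u₂ i k z‖ ≤ (1 - 3 / 8 * (F.w i * F.w k)) * ‖F.f₀ z‖ +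
      F.w i * F.w k / 4 * ‖F.f i z‖ + F.w i * F.w k / 2 * ‖F.f k z‖ := by
    rw [e1]
    refine (norm_add₃_le).trans_eq ?_
    rw [norm_mul, norm_mul, norm_mul, RCLike.norm_ofReal, RCLike.norm_ofReal, RCLike.norm_ofReal,
      abs_of_nonneg (by linarith), abs_of_pos (by positivity), abs_of_pos (by positivity)]
  have e3 := mul_nonneg hm0.le (norm_nonneg (F.f₀ z))
  have e4 : F.w i * F.w k * ‖F.f i z‖ ≤ F.kerSeminorm z := by
    have a1 := mul_le_mul_of_nonneg_right hmi (norm_nonneg (F.f i z))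
    have a2 := mul_le_mul_of_nonneg_left h1 hi0.le
    have a3 := mul_le_mul_of_nonneg_right (F.w_mul_norm_le i) hn
    linarith
  have e5 : F.w i * F.w k * ‖F.f k z‖ ≤ F.kerSeminorm z := by
    have a1 := mul_le_mul_of_nonneg_right hmk (norm_nonneg (F.f k z))
    have a2 := mul_le_mul_of_nonneg_left h1' hk0.le
    have a3 := mul_le_mul_of_nonneg_right (F.w_mul_norm_le k) hn
    linarith
  have e6 := mul_le_mul_of_nonneg_left h2 (by positivity : 0 ≤ ‖F.f₀‖ + 1)
  linarith

lemma base_proj_le (i : I) (z : Y) : F.base (F.proj i z) ≤ (1 + ‖F.f₀‖ * (‖F.e‖ + 1)) * F.base z := by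
  have h0 := F.norm_apply_le F.f₀_j z
  have h2 := mul_le_mul_of_nonneg_left (F.kerSeminorm_le_base z) (norm_nonneg F.f₀)
  have h3 : F.base (F.proj i z) ≤ F.base z + ‖F.f₀ z‖ * F.base (F.y i) := by
    rw [proj_apply]
    refine (map_sub_le_add _ _ _).trans_eq ?_
    rw [map_smul_eq_mul]
  have h4 : ‖F.f₀ z‖ * F.base (F.y i) ≤ ‖F.f₀‖ * F.base z * (‖F.e‖ + 1) :=
    mul_le_mul (by linarith) (F.base_y_le i) (apply_nonneg _ _)
      (mul_nonneg (norm_nonneg _) (apply_nonneg _ _))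
  linarith

lemma spike_le (i : I) (z : Y) : F.spike i z ≤ F.bound * F.base z := by
  have h1 := F.norm_u_le i z
  have h2 := F.base_proj_le i z
  have h3 : F.w i / 24 * F.base (F.proj i z) ≤ F.base (F.proj i z) :=
    mul_le_of_le_one_left (apply_nonneg _ _) (by linarith [F.w_le_one i])
  rw [spike_apply, bound]
  linarith

lemma one_le_bound : 1 ≤ F.bound := by
  have : 0 ≤ ‖F.f₀‖ * (‖F.e‖ + 2) := by positivity
  rw [bound]; linarith

lemma norm_u₂_le_bound (i k : I) (z : Y) : ‖F.u₂ i k z‖ ≤ F.bound * F.base z := by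
  have h1 := F.norm_u₂_le i k z
  have h2 : 0 ≤ (1 + ‖F.f₀‖ * (‖F.e‖ + 1)) * F.base z :=
    mul_nonneg (by positivity) (apply_nonneg _ _)
  rw [bound]
  linarith

/-- The scaling of the base norm. -/
noncomputable def scale : ℝ := (1 + ‖F.e‖)⁻¹

lemma scale_pos : 0 < F.scale := by unfold scale; positivity

lemma scale_le_one : F.scale ≤ 1 := inv_le_one_of_one_le₀ (by linarith [norm_nonneg F.e])

lemma scale_mul : F.scale * (1 + ‖F.e‖) = 1 := inv_mul_cancel₀ (by positivity)

variable [LinearOrder I]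

/-- The seminorms whose supremum is the new norm. -/
noncomputable def pieces : Option (I ⊕ {q : I × I // q.1 < q.2}) → Seminorm 𝕜 Y
  | none => F.scale.toNNReal • F.base
  | some (.inl i) => F.spike i
  | some (.inr q) => (normSeminorm 𝕜 𝕜).comp (F.u₂ q.1.1 q.1.2).toLinearMap

lemma pieces_none (z : Y) : F.pieces none z = F.scale * F.base z := by
  rw [← Real.coe_toNNReal F.scale F.scale_pos.le]; rfl

lemma pieces_le (k) (z : Y) : F.pieces k z ≤ F.bound * F.base z := by
  rcases k with _ | i | q
  · rw [pieces_none]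
    exact mul_le_mul_of_nonneg_right (F.scale_le_one.trans F.one_le_bound) (apply_nonneg _ _)
  · exact F.spike_le i z
  · exact F.norm_u₂_le_bound _ _ z

lemma bddAbove_pieces : BddAbove (range F.pieces) :=
  Seminorm.bddAbove_range_iff.mpr fun z => ⟨_, forall_mem_range.mpr fun k => F.pieces_le k z⟩

/-- The new norm. -/
noncomputable def newNorm : Seminorm 𝕜 Y := ⨆ k, F.pieces k

lemma newNorm_apply (z : Y) : F.newNorm z = ⨆ k, F.pieces k z :=
  Seminorm.iSup_apply F.bddAbove_pieces

lemma pieces_le_newNorm (k) (z : Y) : F.pieces k z ≤ F.newNorm z := by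
  rw [newNorm_apply]
  exact le_ciSup (Seminorm.bddAbove_range_iff.mp F.bddAbove_pieces z) k

lemma scale_mul_base_le (z : Y) : F.scale * F.base z ≤ F.newNorm z :=
  (F.pieces_none z).symm.trans_le (F.pieces_le_newNorm none z)

lemma spike_le_newNorm (i : I) (z : Y) : F.spike i z ≤ F.newNorm z :=
  F.pieces_le_newNorm (some (.inl i)) z

lemma norm_u₂_le_newNorm {i k : I} (h : i < k) (z : Y) : ‖F.u₂ i k z‖ ≤ F.newNorm z :=
  F.pieces_le_newNorm (some (.inr ⟨(i, k), h⟩)) z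

lemma newNorm_le {z : Y} {B : ℝ} (h1 : F.scale * F.base z ≤ B) (h2 : ∀ i, F.spike i z ≤ B)
    (h3 : ∀ i k, i < k → ‖F.u₂ i k z‖ ≤ B) : F.newNorm z ≤ B := by
  rw [newNorm_apply]
  refine ciSup_le ?_
  rintro (_ | i | q)
  exacts [(F.pieces_none z).trans_le h1, h2 i, h3 _ _ q.2]

lemma newNorm_le_base (z : Y) : F.newNorm z ≤ F.bound * F.base z := by
  rw [newNorm_apply]
  exact ciSup_le fun k => F.pieces_le k z

lemma isEquivalentNorm_newNorm : IsEquivalentNorm F.newNorm := by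
  refine ⟨F.scale / (1 + ‖F.j‖), F.bound * (1 + ‖F.j‖ * ‖F.g‖ + ‖F.g‖),
    div_pos F.scale_pos (by positivity),
    mul_pos (by linarith [F.one_le_bound]) (by positivity), fun z => ⟨?_, ?_⟩⟩
  · refine le_trans ?_ (F.scale_mul_base_le z)
    rw [div_mul_eq_mul_div, div_le_iff₀ (by positivity), mul_assoc]
    exact mul_le_mul_of_nonneg_left (by linarith [F.norm_le_base z]) F.scale_pos.le
  · refine (F.newNorm_le_base z).trans ?_
    rw [mul_assoc]
    exact mul_le_mul_of_nonneg_left (F.base_le_norm z) (by linarith [F.one_le_bound])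

end WeightedFrame

/-! ### Values at the apexes and detection of the order -/

namespace WeightedFrame

variable {𝕜 Y I : Type*} [RCLike 𝕜] [NormedAddCommGroup Y] [NormedSpace 𝕜 Y]
variable (F : WeightedFrame 𝕜 Y I)

lemma u_y_self (i : I) : F.u i (F.y i) = ((1 + F.w i / 4 : ℝ) : 𝕜) := by
  rw [F.u_apply i (a := 1) (b := 1) (by simp [F.f₀_y]) (by simp [F.f_y])]
  congr 1; ring

lemma u_y_of_ne {i k : I} (h : i ≠ k) : F.u i (F.y k) = ((1 - 3 / 4 * F.w i : ℝ) : 𝕜) := by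
  rw [F.u_apply i (a := 1) (b := 0) (by simp [F.f₀_y]) (by simp [F.f_y_of_ne h])]
  congr 1; ring

lemma spike_y_self (i : I) : F.spike i (F.y i) = 1 + F.w i / 4 := by
  have := F.w_pos i
  rw [spike_apply, u_y_self, proj_y_self, map_zero, RCLike.norm_ofReal, abs_of_pos (by linarith)]
  ring

lemma spike_y_le_of_ne {i k : I} (h : i ≠ k) : F.spike i (F.y k) ≤ 1 := by
  have h0 := F.w_pos i
  have h1 := F.w_le_one i
  have h2 : F.base (F.proj i (F.y k)) ≤ 2 := by
    rw [proj_apply, F.f₀_y, one_smul]; exact F.base_y_sub_le k i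
  have h3 := mul_le_mul_of_nonneg_left h2 (by linarith : 0 ≤ F.w i / 24)
  rw [spike_apply, F.u_y_of_ne h, RCLike.norm_ofReal, abs_of_nonneg (by linarith)]
  linarith

lemma f_y_eq_ite [DecidableEq I] (i k : I) : F.f i (F.y k) = ((if i = k then 1 else 0 : ℝ) : 𝕜) := by
  split_ifs with h
  · simp [h, F.f_y]
  · simp [F.f_y_of_ne h]

lemma scale_mul_base_y_le (i : I) : F.scale * F.base (F.y i) ≤ 1 := by
  rw [← F.scale_mul, add_comm]
  exact mul_le_mul_of_nonneg_left (F.base_y_le i) F.scale_pos.le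

variable [LinearOrder I]

/-- The bracket in `u₂ i k` is positive only at `l = k`, where it equals 1/2. The product of weights
in its coefficient keeps the excess within half of the excess `w l / 4` of the spike. -/
lemma norm_u₂_y_le {i k : I} (h : i < k) (l : I) : ‖F.u₂ i k (F.y l)‖ ≤ 1 + F.w l / 8 := by
  have hi0 := F.w_pos i
  have hk0 := F.w_pos k
  have hl0 := F.w_pos l
  have hi := F.w_le_one i
  have hm0 : 0 < F.w i * F.w k := mul_pos hi0 hk0
  have hmk : F.w i * F.w k ≤ F.w k := mul_le_of_le_one_left hk0.le hi
  have hk := F.w_le_one k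
  rw [F.u₂_apply i k (a := 1) (by simp [F.f₀_y]) (F.f_y_eq_ite i l) (F.f_y_eq_ite k l),
    RCLike.norm_ofReal, abs_le]
  by_cases h1 : i = l
  · have h2 : k ≠ l := by rintro rfl; exact h.ne h1
    simp only [if_pos h1, if_neg h2]
    constructor <;> linarith
  · by_cases h2 : k = l
    · subst h2
      simp only [if_neg h1, if_true]
      constructor <;> linarith
    · simp only [if_neg h1, if_neg h2]
      constructor <;> linarith

lemma newNorm_y (i : I) : F.newNorm (F.y i) = 1 + F.w i / 4 := by
  have h0 := F.w_pos i
  refine le_antisymm (F.newNorm_le ?_ (fun k => ?_) fun k l h => ?_)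
    ((F.spike_y_self i).symm.trans_le (F.spike_le_newNorm i _))
  · linarith [F.scale_mul_base_y_le i]
  · by_cases h : k = i
    · rw [h, spike_y_self]
    · linarith [F.spike_y_le_of_ne h]
  · linarith [F.norm_u₂_y_le h i]

/-- Close to the apex `y i`, the new norm is given by the single piece `spike i`. -/
lemma exists_newNorm_eq_spike (i : I) :
    ∃ r > 0, ∀ z, F.base (z - F.y i) < r → F.newNorm z = F.spike i z := by
  have h0 := F.w_pos i
  have hC := F.one_le_bound
  -- On this ball every piece changes by at most `w i / 16`, half of the gap `w i / 8` between
  -- `spike i` and the other pieces at `y i`.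
  refine ⟨F.w i / (16 * F.bound), by positivity, fun z hz => ?_⟩
  rw [lt_div_iff₀ (by positivity)] at hz
  have key : ∀ k, F.pieces k z ≤ F.pieces k (F.y i) + F.w i / 16 := fun k => by
    have h1 : F.pieces k z ≤ F.pieces k (F.y i) + F.pieces k (z - F.y i) := by
      simpa using map_add_le_add (F.pieces k) (F.y i) (z - F.y i)
    have h2 := F.pieces_le k (z - F.y i)
    linarith
  have hs : 1 + F.w i / 4 - F.w i / 16 ≤ F.spike i z := by
    have h1 : F.spike i (F.y i) ≤ F.spike i z + F.spike i (z - F.y i) := by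
      have := map_sub_le_add (F.spike i) z (z - F.y i)
      rwa [sub_sub_cancel] at this
    have h2 := F.spike_le i (z - F.y i)
    rw [spike_y_self] at h1
    linarith
  refine le_antisymm (F.newNorm_le ?_ (fun k => ?_) fun k l h => ?_) (F.spike_le_newNorm i z)
  · have h1 := key none
    rw [pieces_none, pieces_none] at h1
    linarith [F.scale_mul_base_y_le i]
  · by_cases h : k = i
    · rw [h]
    · have h1 : F.spike k z ≤ F.spike k (F.y i) + F.w i / 16 := key (some (.inl k))
      linarith [F.spike_y_le_of_ne h]
  · have h1 : ‖F.u₂ k l z‖ ≤ ‖F.u₂ k l (F.y i)‖ + F.w i / 16 := key (some (.inr ⟨(k, l), h⟩))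
    linarith [F.norm_u₂_y_le h i]

/-- The new norm sees the order of the index set. -/
lemma three_lt_newNorm_iff {i k : I} (h : i ≠ k) :
    3 < F.newNorm (F.y i + 2 • F.y k) ↔ i < k := by
  have hf₀ : F.f₀ (F.y i + 2 • F.y k) = ((3 : ℝ) : 𝕜) := by
    simp only [map_add, map_nsmul, F.f₀_y, RCLike.ofReal_ofNat]; norm_num
  have hf : ∀ l, F.f l (F.y i + 2 • F.y k) =
      (((if l = i then 1 else 0) + 2 * (if l = k then 1 else 0) : ℝ) : 𝕜) := fun l => by
    simp only [map_add, map_nsmul, F.f_y_eq_ite, nsmul_eq_mul]; push_cast; ring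
  constructor
  · contrapose!
    intro hik
    refine F.newNorm_le ?_ (fun l => ?_) fun l m hlm => ?_
    · have h1 : F.base (F.y i + 2 • F.y k) ≤ F.base (F.y i) + 2 * F.base (F.y k) := by
        refine (map_add_le_add _ _ _).trans_eq ?_
        rw [two_smul, two_mul, ← two_smul 𝕜 (F.y k), map_smul_eq_mul]
        simp [two_mul]
      have h2 := mul_le_mul_of_nonneg_left h1 F.scale_pos.le
      linarith [F.scale_mul_base_y_le i, F.scale_mul_base_y_le k]
    · have h0 := F.w_pos l
      have h1 := F.w_le_one l
      have h2 : F.base (F.proj l (F.y i + 2 • F.y k)) ≤ 6 := by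
        have e1 : F.proj l (F.y i + 2 • F.y k) =
            (F.y i - F.y l) + ((F.y k - F.y l) + (F.y k - F.y l)) := by
          rw [proj_apply, hf₀]
          have : ((3 : ℝ) : 𝕜) • F.y l = F.y l + F.y l + F.y l := by
            rw [← one_smul 𝕜 (F.y l), smul_smul, ← add_smul, ← add_smul, RCLike.ofReal_ofNat]; norm_num
          rw [this, two_smul]; abel
        rw [e1]
        have e2 := map_add_le_add F.base (F.y i - F.y l) ((F.y k - F.y l) + (F.y k - F.y l))
        have e3 := map_add_le_add F.base (F.y k - F.y l) (F.y k - F.y l)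
        linarith [F.base_y_sub_le i l, F.base_y_sub_le k l]
      have h3 := mul_le_mul_of_nonneg_left h2 (by linarith : 0 ≤ F.w l / 24)
      rw [spike_apply]
      -- The base term costs at most `6 * w l / 24 = w l / 4`.
      suffices ‖F.u l (F.y i + 2 • F.y k)‖ ≤ 3 - F.w l / 4 by linarith
      rw [F.u_apply l hf₀ (hf l), RCLike.norm_ofReal, abs_le]
      by_cases e1 : l = i
      · have e2 : l ≠ k := by rwa [e1]
        simp only [if_pos e1, if_neg e2]
        constructor <;> linarith
      · by_cases e2 : l = k
        · simp only [if_neg e1, if_pos e2]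
          constructor <;> linarith
        · simp only [if_neg e1, if_neg e2]
          constructor <;> linarith
    · have hm0 : 0 < F.w l * F.w m := mul_pos (F.w_pos l) (F.w_pos m)
      have hm1 : F.w l * F.w m ≤ 1 := mul_le_one₀ (F.w_le_one l) (F.w_pos m).le (F.w_le_one m)
      rw [F.u₂_apply l m hf₀ (hf l) (hf m), RCLike.norm_ofReal, abs_le]
      -- For every pair other than `(i, k)` the bracket is at most `-1/2`.
      have hne : ¬ (l = i ∧ m = k) := by rintro ⟨rfl, rfl⟩; exact absurd hlm (not_lt.mpr hik)
      have hlm' := hlm.ne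
      split_ifs <;> first | (exfalso; grind) | (constructor <;> linarith)
  · intro hik
    have hm0 : 0 < F.w i * F.w k := mul_pos (F.w_pos i) (F.w_pos k)
    refine lt_of_lt_of_le ?_ (F.norm_u₂_le_newNorm hik _)
    rw [F.u₂_apply i k hf₀ (hf i) (hf k), RCLike.norm_ofReal]
    refine lt_of_lt_of_le ?_ (le_abs_self _)
    simp only [if_true, if_neg h, if_neg h.symm]
    linarith

end WeightedFrame

/-! ### Kinks and their invariance -/

section Kink

variable {𝕜 Y : Type*} [RCLike 𝕜] [NormedAddCommGroup Y] [NormedSpace 𝕜 Y]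

/-- The seminorm `p` has a kink of strength `c` at `z`: its second symmetric difference at `z` grows
linearly in all directions other than those of the line through `z`. -/
def Seminorm.IsKink (p : Seminorm 𝕜 Y) (c : ℝ) (z : Y) : Prop :=
  0 < p z ∧ ∀ v, ∃ a : 𝕜, 2 * p z + c * p (v - a • z) ≤ p (z + v) + p (z - v)

lemma Seminorm.IsKink.map {p : Seminorm 𝕜 Y} {c : ℝ} {z : Y} (h : p.IsKink c z)
    {L : Y →L[𝕜] Y} (hL : L ∈ isometryGroupOf p) : p.IsKink c (L z) := by
  refine ⟨by rw [hL.2]; exact h.1, fun v => ?_⟩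
  obtain ⟨v, rfl⟩ := hL.1 v
  obtain ⟨a, ha⟩ := h.2 v
  refine ⟨a, ?_⟩
  rw [← map_smul L, ← map_sub L, ← map_add L, ← map_sub L, hL.2, hL.2, hL.2, hL.2]
  exact ha

/-- Pulling back tests only directions in the range of `L`, so surjectivity is not needed. -/
lemma Seminorm.IsKink.of_map {p : Seminorm 𝕜 Y} {c : ℝ} {z : Y} {L : Y →L[𝕜] Y}
    (h : p.IsKink c (L z)) (hL : ∀ x, p (L x) = p x) : p.IsKink c z := by
  refine ⟨by rw [← hL]; exact h.1, fun v => ?_⟩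
  obtain ⟨a, ha⟩ := h.2 (L v)
  refine ⟨a, ?_⟩
  rwa [← map_smul L, ← map_sub L, ← map_add L, ← map_sub L, hL, hL, hL, hL] at ha

lemma Seminorm.IsKink.of_smul {p : Seminorm 𝕜 Y} {c : ℝ} {z : Y} {b : 𝕜}
    (h : p.IsKink c (b • z)) : p.IsKink c z := by
  have h1 := h.1
  rw [map_smul_eq_mul] at h1
  have hz : 0 < p z := pos_of_mul_pos_right h1 (norm_nonneg _)
  have hb : 0 < ‖b‖ := pos_of_mul_pos_left h1 hz.le
  refine ⟨hz, fun v => ?_⟩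
  obtain ⟨a, ha⟩ := h.2 (b • v)
  refine ⟨a, ?_⟩
  rw [smul_comm a b z, ← smul_sub, ← smul_sub, ← smul_add, map_smul_eq_mul, map_smul_eq_mul,
    map_smul_eq_mul, map_smul_eq_mul] at ha
  refine le_of_mul_le_mul_left ?_ hb
  linarith

end Kink

/-- This is why the Euclidean block has dimension two: a line has no room orthogonal to a nonzero
vector. -/
lemma exists_norm_eq_one_inner_eq_zero {𝕜 : Type*} [RCLike 𝕜] (a : EuclideanSpace 𝕜 (Fin 2)) :
    ∃ b : EuclideanSpace 𝕜 (Fin 2), ‖b‖ = 1 ∧ inner 𝕜 a b = 0 := by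
  have h1 := Submodule.finrank_add_finrank_orthogonal (𝕜 ∙ a)
  have h2 : Module.finrank 𝕜 (𝕜 ∙ a) ≤ 1 := by
    simpa using finrank_span_le_card (R := 𝕜) ({a} : Set (EuclideanSpace 𝕜 (Fin 2)))
  rw [finrank_euclideanSpace, Fintype.card_fin] at h1
  have : Nontrivial (𝕜 ∙ a)ᗮ := Module.nontrivial_of_finrank_pos (R := 𝕜) (by omega)
  obtain ⟨b, hb⟩ := exists_ne (0 : (𝕜 ∙ a)ᗮ)
  have hb' : (b : EuclideanSpace 𝕜 (Fin 2)) ≠ 0 := by simpa using hb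
  refine ⟨((‖(b : EuclideanSpace 𝕜 (Fin 2))‖⁻¹ : ℝ) : 𝕜) • b, ?_, ?_⟩
  · rw [norm_smul, RCLike.norm_ofReal, abs_of_nonneg (by positivity),
      inv_mul_cancel₀ (norm_ne_zero_iff.mpr hb')]
  · rw [inner_smul_right, Submodule.mem_orthogonal_singleton_iff_inner_right.mp b.2, mul_zero]

/-! ### Location and strength of the kinks of the new norm -/

namespace WeightedFrame

variable {𝕜 Y I : Type*} [RCLike 𝕜] [NormedAddCommGroup Y] [NormedSpace 𝕜 Y]
variable (F : WeightedFrame 𝕜 Y I)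

lemma spike_add_j (i : I) (z : Y) (b) : F.spike i (z + F.j b) =
    ‖F.u i z‖ + F.w i / 24 * max (F.kerSeminorm (F.proj i z)) ‖F.g z + b‖ := by
  rw [spike_apply, map_add, F.u_j, add_zero, proj_add_j, base_add_j, g_proj]

lemma base_proj (i : I) (z : Y) :
    F.base (F.proj i z) = max (F.kerSeminorm (F.proj i z)) ‖F.g z‖ := by
  rw [← F.g_proj i]; rfl

lemma eq_zero_of_base_eq_zero {z : Y} (h : F.base z = 0) : z = 0 := by
  have := F.norm_le_base z
  rw [h, mul_zero] at this
  exact norm_le_zero_iff.mp this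

lemma norm_f_lt {i : I} {η : ℝ} (h : η < F.w i / 24) : ‖F.f i‖ * η < 1 := by
  have h1 := F.w_mul_norm_le i
  have h2 := F.w_pos i
  nlinarith [norm_nonneg (F.f i), mul_le_mul_of_nonneg_left h.le (norm_nonneg (F.f i))]

variable [LinearOrder I]

/-- The two values of `|u i|` sum to at least `2 * (1 + w i / 4)`, while the base term vanishes at
`y i` and grows linearly on both sides. Since `v - f₀ v • y i` is `proj i v`, the scalar is `f₀ v`.
-/
lemma isKink_y (i : I) : F.newNorm.IsKink (F.w i / (12 * F.bound)) (F.y i) := by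
  have hw := F.w_pos i
  have hC := F.one_le_bound
  refine ⟨by rw [newNorm_y]; positivity, fun v => ⟨F.f₀ v, ?_⟩⟩
  have h1 := F.spike_le_newNorm i (F.y i + v)
  have h2 := F.spike_le_newNorm i (F.y i - v)
  rw [spike_apply, map_add, map_add, proj_y_self, zero_add] at h1
  rw [spike_apply, map_sub, map_sub, proj_y_self, zero_sub, map_neg_eq_map] at h2
  have h3 : 2 * (1 + F.w i / 4) ≤ ‖F.u i (F.y i) + F.u i v‖ + ‖F.u i (F.y i) - F.u i v‖ := by
    refine le_trans ?_ (norm_add_le _ _)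
    rw [add_add_sub_cancel, ← two_mul, norm_mul, u_y_self, RCLike.norm_ofReal, RCLike.norm_two,
      abs_of_pos (by positivity)]
  have h4 := F.newNorm_le_base (F.proj i v)
  rw [newNorm_y, ← proj_apply]
  have h5 : F.w i / (12 * F.bound) * F.newNorm (F.proj i v) ≤
      F.w i / (12 * F.bound) * (F.bound * F.base (F.proj i v)) := by gcongr
  have h6 : F.w i / (12 * F.bound) * (F.bound * F.base (F.proj i v)) =
      F.w i / 12 * F.base (F.proj i v) := by field_simp
  linarith

/-- In block directions the norm near `y i` grows at the exact rate `w i / 24` on each side, which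
caps the strength. -/
lemma strength_le {c : ℝ} (hc : 0 < c) {i : I} (h : F.newNorm.IsKink c (F.y i)) :
    c * F.scale ≤ F.w i / 12 := by
  obtain ⟨r, hr, hloc⟩ := F.exists_newNorm_eq_spike i
  obtain ⟨b, hb, -⟩ := exists_norm_eq_one_inner_eq_zero (0 : EuclideanSpace 𝕜 (Fin 2))
  have hval : ∀ b', ‖b'‖ = r / 2 → F.newNorm (F.y i + F.j b') = 1 + F.w i / 4 + F.w i / 24 * (r / 2) := by
    intro b' hb'
    have h0 : F.base (F.j b') = r / 2 := by
      have := F.base_add_j 0 b'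
      rw [zero_add, map_zero, map_zero, zero_add, hb', max_eq_right (by positivity)] at this
      exact this
    rw [hloc _ (by rw [add_sub_cancel_left, h0]; linarith), spike_add_j, proj_y_self, map_zero,
      g_y, zero_add, hb', max_eq_right (by positivity), u_y_self, RCLike.norm_ofReal,
      abs_of_pos (by linarith [F.w_pos i])]
  have hb' : ‖((r / 2 : ℝ) : 𝕜) • b‖ = r / 2 := by
    rw [norm_smul, hb, RCLike.norm_ofReal, abs_of_pos (by positivity), mul_one]
  obtain ⟨a, ha⟩ := h.2 (F.j (((r / 2 : ℝ) : 𝕜) • b))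
  rw [sub_eq_add_neg (F.y i), ← map_neg F.j, hval _ hb', hval _ (by rw [norm_neg, hb']),
    newNorm_y] at ha
  have h1 : F.scale * (r / 2) ≤ F.newNorm (F.j (((r / 2 : ℝ) : 𝕜) • b) - a • F.y i) := by
    refine le_trans ?_ (F.scale_mul_base_le _)
    refine mul_le_mul_of_nonneg_left (le_trans ?_ (F.norm_g_le_base _)) F.scale_pos.le
    rw [map_sub, F.g_j, map_smul, g_y, smul_zero, sub_zero, hb']
  have h2 := mul_le_mul_of_nonneg_left h1 hc.le
  nlinarith

lemma eq_o_of_isKink {i : I} (h : F.newNorm.IsKink (F.w F.o / (12 * F.bound)) (F.y i)) :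
    i = F.o := by
  by_contra hi
  have h1 := F.w_mul_lt i hi
  have hw := F.w_pos F.o
  have hC := F.one_le_bound
  have h2 := F.strength_le (by positivity) h
  have h3 := mul_le_mul_of_nonneg_right h2 (by positivity : 0 ≤ 12 * F.bound * (1 + ‖F.e‖))
  have h4 : F.w F.o / (12 * F.bound) * F.scale * (12 * F.bound * (1 + ‖F.e‖)) =
      F.w F.o * (F.scale * (1 + ‖F.e‖)) := by field_simp
  rw [h4, scale_mul] at h3
  rw [bound] at h3
  linarith

/-- A piece sees the block at most through a maximum involving the norm of the `g`-component, with
coefficient at most 1. -/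
lemma newNorm_add_j_le (z : Y) (b) :
    F.newNorm (z + F.j b) ≤ F.newNorm z + max 0 (‖F.g z + b‖ - ‖F.g z‖) := by
  have key : ∀ s : ℝ, max s ‖F.g z + b‖ ≤ max s ‖F.g z‖ + max 0 (‖F.g z + b‖ - ‖F.g z‖) := by
    intro s
    have h1 := le_max_left s ‖F.g z‖
    have h2 := le_max_right s ‖F.g z‖
    have h3 := le_max_left 0 (‖F.g z + b‖ - ‖F.g z‖)
    have h4 := le_max_right 0 (‖F.g z + b‖ - ‖F.g z‖)
    apply max_le <;> linarith
  have h0 : 0 ≤ max 0 (‖F.g z + b‖ - ‖F.g z‖) := le_max_left _ _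
  refine F.newNorm_le ?_ (fun i => ?_) fun i k h => ?_
  · have h1 := F.scale_mul_base_le z
    have h2 : F.base (z + F.j b) ≤ F.base z + max 0 (‖F.g z + b‖ - ‖F.g z‖) := by
      rw [base_add_j]; exact key _
    nlinarith [F.scale_pos, F.scale_le_one]
  · have h1 := F.spike_le_newNorm i z
    rw [spike_apply, base_proj] at h1
    rw [spike_add_j]
    have h2 := key (F.kerSeminorm (F.proj i z))
    nlinarith [F.w_pos i, F.w_le_one i]
  · have h1 := F.norm_u₂_le_newNorm h z
    rw [map_add, u₂_j, add_zero]
    linarith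

/-- A short move along the block is hidden by the kernel component, except in spikes with `proj i z`
shorter than `b`; those grow at rate at most `w i / 24`. -/
lemma newNorm_add_j_le_of_g_eq_zero {z : Y} (hz : F.g z = 0) {b} (hb : ‖b‖ ≤ F.kerSeminorm z)
    {η : ℝ} (hη : 0 ≤ η) (h : ∀ i, F.kerSeminorm (F.proj i z) < ‖b‖ → F.w i / 24 ≤ η) :
    F.newNorm (z + F.j b) ≤ F.newNorm z + η * ‖b‖ := by
  have h0 : 0 ≤ η * ‖b‖ := by positivity
  refine F.newNorm_le ?_ (fun i => ?_) fun i k h => ?_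
  · have h1 := F.scale_mul_base_le z
    have h2 : F.base (z + F.j b) = F.base z := by
      rw [base_add_j, hz, zero_add, max_eq_left hb]
      rw [base_of_g_eq_zero _ hz, kerSeminorm_apply, hz, map_zero, sub_zero]
    rw [h2]; linarith
  · have h1 := F.spike_le_newNorm i z
    rw [spike_apply, base_proj] at h1
    rw [spike_add_j, hz, zero_add]
    rw [hz, norm_zero, max_eq_left (apply_nonneg _ _)] at h1
    have hw := F.w_pos i
    rcases lt_or_ge (F.kerSeminorm (F.proj i z)) ‖b‖ with hlt | hge
    · rw [max_eq_right hlt.le]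
      have h2 := mul_le_mul_of_nonneg_right (h i hlt) (norm_nonneg b)
      have h3 : 0 ≤ F.w i / 24 * F.kerSeminorm (F.proj i z) :=
        mul_nonneg (by positivity) (apply_nonneg _ _)
      linarith
    · rw [max_eq_left hge]; linarith
  · have h1 := F.norm_u₂_le_newNorm h z
    rw [map_add, u₂_j, add_zero]
    linarith

/-- A kink in the kernel of `g` is approximated by apex lines of large weight. -/
lemma exists_kerSeminorm_proj_lt {c : ℝ} (hc : 0 < c) {z : Y} (hz : F.newNorm.IsKink c z)
    (hg : F.g z = 0) {t : ℝ} (ht : 0 < t) (htz : t ≤ F.kerSeminorm z) :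
    ∃ i, F.kerSeminorm (F.proj i z) < t ∧ c * F.scale / 4 < F.w i / 24 := by
  -- Otherwise the two moves of length `t` along the block together cost at most half of what the
  -- kink demands.
  by_contra! hcon
  have hs := F.scale_pos
  obtain ⟨b, hb, -⟩ := exists_norm_eq_one_inner_eq_zero (0 : EuclideanSpace 𝕜 (Fin 2))
  have hb' : ‖(t : 𝕜) • b‖ = t := by
    rw [norm_smul, hb, RCLike.norm_ofReal, abs_of_pos ht, mul_one]
  have key : ∀ b', ‖b'‖ = t → F.newNorm (z + F.j b') ≤ F.newNorm z + c * F.scale / 4 * t := by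
    intro b' h
    have := F.newNorm_add_j_le_of_g_eq_zero hg (b := b') (by rwa [h]) (η := c * F.scale / 4)
      (by positivity) (fun i hi => hcon i (by rwa [h] at hi))
    rwa [h] at this
  obtain ⟨a, ha⟩ := hz.2 (F.j ((t : 𝕜) • b))
  have h1 := key _ hb'
  have h2 := key (-((t : 𝕜) • b)) (by rw [norm_neg, hb'])
  rw [map_neg, ← sub_eq_add_neg] at h2
  have h3 : F.scale * t ≤ F.newNorm (F.j ((t : 𝕜) • b) - a • z) := by
    refine le_trans ?_ (F.scale_mul_base_le _)
    refine mul_le_mul_of_nonneg_left (le_trans ?_ (F.norm_g_le_base _)) hs.le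
    rw [map_sub, F.g_j, map_smul, hg, smul_zero, sub_zero, hb']
  have h4 := mul_le_mul_of_nonneg_left h3 hc.le
  have h5 : 0 < c * (F.scale * t) := by positivity
  linarith

/-- All kinks lie in the kernel of `g`. -/
lemma g_eq_zero_of_isKink {c : ℝ} (hc : 0 < c) {z : Y} (hz : F.newNorm.IsKink c z) :
    F.g z = 0 := by
  by_contra hg
  have hn : 0 < ‖F.g z‖ := norm_pos_iff.mpr hg
  have hs := F.scale_pos
  obtain ⟨b, hb, hab⟩ := exists_norm_eq_one_inner_eq_zero (F.g z)
  -- An orthogonal move raises the norm only quadratically, by at most `t ^ 2 / (2 * ‖g z‖)`. This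
  -- `t` makes that `c * scale * t / 4`, too little for a kink.
  set t : ℝ := c * F.scale * ‖F.g z‖ / 2 with ht
  have ht0 : 0 < t := by positivity
  have hb' : ‖(t : 𝕜) • b‖ = t := by
    rw [norm_smul, hb, RCLike.norm_ofReal, abs_of_pos ht0, mul_one]
  have key : ∀ b', ‖b'‖ = t → inner 𝕜 (F.g z) b' = 0 →
      F.newNorm (z + F.j b') ≤ F.newNorm z + t ^ 2 / (2 * ‖F.g z‖) := by
    intro b' h h'
    refine (F.newNorm_add_j_le z b').trans ?_
    gcongr
    refine max_le (by positivity) ?_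
    have h1 := norm_add_sq (𝕜 := 𝕜) (F.g z) b'
    rw [h', h, map_zero, mul_zero, add_zero] at h1
    rw [sub_le_iff_le_add]
    refine le_of_sq_le_sq ?_ (by positivity)
    rw [h1]
    have : t ^ 2 / (2 * ‖F.g z‖) * ‖F.g z‖ = t ^ 2 / 2 := by field_simp
    nlinarith [sq_nonneg (t ^ 2 / (2 * ‖F.g z‖))]
  obtain ⟨a, ha⟩ := hz.2 (F.j ((t : 𝕜) • b))
  have h1 := key _ hb' (by rw [inner_smul_right, hab, mul_zero])
  have h2 := key (-((t : 𝕜) • b)) (by rw [norm_neg, hb'])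
    (by rw [inner_neg_right, inner_smul_right, hab, mul_zero, neg_zero])
  rw [map_neg, ← sub_eq_add_neg] at h2
  have h3 : F.scale * t ≤ F.newNorm (F.j ((t : 𝕜) • b) - a • z) := by
    refine le_trans ?_ (F.scale_mul_base_le _)
    refine mul_le_mul_of_nonneg_left (le_trans ?_ (F.norm_g_le_base _)) hs.le
    rw [map_sub, F.g_j, map_smul]
    refine le_of_sq_le_sq ?_ (norm_nonneg _)
    -- By orthogonality, subtracting a multiple of `g z` cannot shorten the displacement.
    have h5 := norm_sub_sq (𝕜 := 𝕜) ((t : 𝕜) • b) (a • F.g z)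
    rw [inner_smul_left, inner_smul_right, inner_eq_zero_symm.mp hab, mul_zero, mul_zero, map_zero,
      mul_zero, sub_zero, hb'] at h5
    rw [h5]
    linarith [sq_nonneg ‖a • F.g z‖]
  have h4 := mul_le_mul_of_nonneg_left h3 hc.le
  have h5 : t ^ 2 / (2 * ‖F.g z‖) = c * (F.scale * t) / 4 := by
    rw [sq, div_eq_iff (by positivity)]; nth_rewrite 1 [ht]; ring
  have h6 : 0 < c * (F.scale * t) := by positivity
  linarith

/-- All kinks lie on the lines spanned by the apex vectors. -/
lemma exists_eq_smul_y_of_isKink {c : ℝ} (hc : 0 < c) {z : Y} (hz : F.newNorm.IsKink c z) :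
    ∃ i, ∃ a : 𝕜, z = a • F.y i := by
  by_contra! hcon
  have hg := F.g_eq_zero_of_isKink hc hz
  have hz0 : 0 < F.kerSeminorm z := by
    have h1 := hz.1.trans_le (F.newNorm_le_base z)
    have h2 : 0 < F.base z := pos_of_mul_pos_right h1 (by linarith [F.one_le_bound])
    rw [F.base_of_g_eq_zero hg] at h2
    simpa [kerSeminorm_apply, hg] using h2
  have hproj : ∀ i, 0 < F.kerSeminorm (F.proj i z) := fun i => by
    have : F.kerSeminorm (F.proj i z) = ‖F.proj i z‖ := by
      simp [kerSeminorm_apply, g_proj, hg]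
    rw [this, norm_pos_iff, proj_apply, sub_ne_zero]
    exact hcon i _
  have hs := F.scale_pos
  set η := c * F.scale / 4 with hη
  have hη0 : 0 < η := by positivity
  by_cases hf : F.f₀ z = 0
  · obtain ⟨i, hi, -⟩ := F.exists_kerSeminorm_proj_lt hc hz hg hz0 le_rfl
    rw [proj_apply, hf, zero_smul, sub_zero] at hi
    exact lt_irrefl _ hi
  · have hf' : 0 < ‖F.f₀ z‖ := norm_pos_iff.mpr hf
    -- Two distinct apex lines come close to `z`: the second closer than the first, hence different.
    -- But `f i` separates `f₀ z • y i` from `f₀ z • y k` by `‖f₀ z‖`, and the lower bound on `w i`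
    -- bounds `‖f i‖`.
    obtain ⟨i, hi, hwi⟩ := F.exists_kerSeminorm_proj_lt hc hz hg
      (t := min (F.kerSeminorm z) (‖F.f₀ z‖ * η / 2)) (lt_min hz0 (by positivity)) (min_le_left _ _)
    obtain ⟨k, hk, -⟩ := F.exists_kerSeminorm_proj_lt hc hz hg
      (t := min (F.kerSeminorm (F.proj i z)) (min (F.kerSeminorm z) (‖F.f₀ z‖ * η / 2)))
      (lt_min (hproj i) (lt_min hz0 (by positivity))) ((min_le_right _ _).trans (min_le_left _ _))
    have hik : i ≠ k := by
      rintro rfl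
      exact lt_irrefl _ (hk.trans_le (min_le_left _ _))
    have hi' := hi.trans_le (min_le_right _ _)
    have hk' := hk.trans_le ((min_le_right _ _).trans (min_le_right _ _))
    have h1 : ‖F.f₀ z‖ = ‖F.f i (F.proj k z - F.proj i z)‖ := by
      simp [proj_apply, F.f_y, F.f_y_of_ne hik]
    have h2 := F.norm_apply_le (F.f_j i) (F.proj k z - F.proj i z)
    have h3 := map_sub_le_add F.kerSeminorm (F.proj k z) (F.proj i z)
    have h4 : ‖F.f i‖ * F.kerSeminorm (F.proj k z - F.proj i z) ≤ ‖F.f i‖ * (‖F.f₀ z‖ * η) :=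
      mul_le_mul_of_nonneg_left (by linarith) (norm_nonneg _)
    have h5 : ‖F.f₀ z‖ * (‖F.f i‖ * η) < ‖F.f₀ z‖ * 1 :=
      mul_lt_mul_of_pos_left (F.norm_f_lt hwi) hf'
    linarith

end WeightedFrame

/-! ### Supporting functionals and rigidity of isometries -/

lemma tendsto_norm_add_sub_norm_sub_div {𝕜 : Type*} [RCLike 𝕜] {α : ℝ} (hα : 0 < α) (b : 𝕜) :
    Tendsto (fun t : ℝ => (‖(α : 𝕜) + t * b‖ - ‖(α : 𝕜) - t * b‖) / t) (𝓝[>] 0)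
      (𝓝 (2 * RCLike.re b)) := by
  have hpos : ∀ t : ℝ, 0 < ‖(α : 𝕜) + t * b‖ + ‖(α : 𝕜) - t * b‖ := fun t => by
    have h1 := norm_add_le ((α : 𝕜) + t * b) ((α : 𝕜) - t * b)
    rw [add_add_sub_cancel, ← two_mul, norm_mul, RCLike.norm_two, RCLike.norm_ofReal,
      abs_of_pos hα] at h1
    linarith
  -- Multiplying by the sum of the two norms gives a difference of squares, which is linear in `t`.
  have hlim : Tendsto (fun t : ℝ => 4 * α * RCLike.re b /
      (‖(α : 𝕜) + t * b‖ + ‖(α : 𝕜) - t * b‖)) (𝓝[>] 0) (𝓝 (2 * RCLike.re b)) := by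
    have hc : ContinuousAt (fun t : ℝ => 4 * α * RCLike.re b /
        (‖(α : 𝕜) + t * b‖ + ‖(α : 𝕜) - t * b‖)) 0 := by
      refine ContinuousAt.div continuousAt_const ?_ (hpos 0).ne'
      fun_prop
    have h0 := hc.tendsto.mono_left (nhdsWithin_le_nhds (s := Ioi 0))
    convert h0 using 2
    simp only [RCLike.ofReal_zero, zero_mul, add_zero, sub_zero, RCLike.norm_ofReal, abs_of_pos hα]
    field_simp
    ring
  refine hlim.congr' ?_
  filter_upwards [self_mem_nhdsWithin] with t ht
  have ht : (0 : ℝ) < t := ht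
  rw [div_eq_div_iff (hpos t).ne' ht.ne']
  have h1 : ‖(α : 𝕜) + t * b‖ ^ 2 - ‖(α : 𝕜) - t * b‖ ^ 2 = 4 * α * RCLike.re b * t := by
    rw [RCLike.norm_sq_eq_def, RCLike.norm_sq_eq_def]
    simp
    ring
  rw [← h1]; ring

namespace WeightedFrame

variable {𝕜 Y I : Type*} [RCLike 𝕜] [NormedAddCommGroup Y] [NormedSpace 𝕜 Y]
variable (F : WeightedFrame 𝕜 Y I)

lemma u_y_ne_zero (i k : I) : F.u i (F.y k) ≠ 0 := by
  have h0 := F.w_pos i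
  have h1 := F.w_le_one i
  rw [← norm_pos_iff]
  by_cases h : i = k
  · rw [← h, u_y_self, RCLike.norm_ofReal]
    exact abs_pos_of_pos (by linarith)
  · rw [F.u_y_of_ne h, RCLike.norm_ofReal]
    exact abs_pos_of_pos (by linarith)

lemma eq_of_smul_y_eq_smul_y {i k : I} {a b : 𝕜} (ha : a ≠ 0) (h : a • F.y i = b • F.y k) :
    i = k := by
  by_contra hik
  have := congrArg (F.f i) h
  rw [map_smul, map_smul, f_y, F.f_y_of_ne hik, smul_zero, smul_eq_mul, mul_one] at this
  exact ha this

variable [LinearOrder I]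

/-- Near an apex, the odd part of the new norm determines the supporting functional. -/
lemma tendsto_newNorm_sub_div (i : I) (v : Y) :
    Tendsto (fun t : ℝ => (F.newNorm (F.y i + (t : 𝕜) • v) - F.newNorm (F.y i - (t : 𝕜) • v)) / t)
      (𝓝[>] 0) (𝓝 (2 * RCLike.re (F.u i v))) := by
  have hw := F.w_pos i
  refine (tendsto_norm_add_sub_norm_sub_div (by positivity : 0 < 1 + F.w i / 4)
    (F.u i v)).congr' ?_
  obtain ⟨r, hr, hloc⟩ := F.exists_newNorm_eq_spike i
  have hsmall : ∀ᶠ t : ℝ in 𝓝[>] 0, t * F.base v < r := by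
    have : ContinuousAt (fun t : ℝ => t * F.base v) 0 := by fun_prop
    exact (this.eventually_lt continuousAt_const (by simpa using hr)).filter_mono
      nhdsWithin_le_nhds
  filter_upwards [hsmall, self_mem_nhdsWithin] with t ht ht0
  have ht0 : (0 : ℝ) < t := ht0
  have hb : F.base ((t : 𝕜) • v) = t * F.base v := by
    rw [map_smul_eq_mul, RCLike.norm_ofReal, abs_of_pos ht0]
  -- The base term of the spike is even in `t` and cancels.
  rw [hloc _ (by rwa [add_sub_cancel_left, hb]),
    hloc _ (by rwa [sub_sub_cancel_left, map_neg_eq_map, hb]), spike_apply, spike_apply,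
    map_add (F.proj i), map_sub (F.proj i), proj_y_self, zero_add, zero_sub, map_neg_eq_map,
    map_add, map_sub, map_smul, smul_eq_mul, u_y_self, add_sub_add_right_eq_sub]

/-- `L` preserves the norm and fixes `y i`, hence preserves the derivative of the odd part there,
which is twice the real part of `u i`. -/
lemma u_map_of_map_y_eq {L : Y →L[𝕜] Y} (hL : ∀ z, F.newNorm (L z) = F.newNorm z) {i : I}
    (hi : L (F.y i) = F.y i) (v : Y) : F.u i (L v) = F.u i v := by
  have hre : ∀ v, RCLike.re (F.u i (L v)) = RCLike.re (F.u i v) := fun v => by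
    have h1 := F.tendsto_newNorm_sub_div i (L v)
    have h2 : ∀ t : ℝ, F.newNorm (F.y i + (t : 𝕜) • L v) = F.newNorm (F.y i + (t : 𝕜) • v) :=
      fun t => by rw [← hL (F.y i + (t : 𝕜) • v), map_add L, map_smul L, hi]
    have h3 : ∀ t : ℝ, F.newNorm (F.y i - (t : 𝕜) • L v) = F.newNorm (F.y i - (t : 𝕜) • v) :=
      fun t => by rw [← hL (F.y i - (t : 𝕜) • v), map_sub L, map_smul L, hi]
    simp only [h2, h3] at h1
    linarith [tendsto_nhds_unique h1 (F.tendsto_newNorm_sub_div i v)]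
  refine RCLike.ext (hre v) ?_
  have := hre ((RCLike.I : 𝕜) • v)
  simp only [map_smul, smul_eq_mul, RCLike.I_mul_re, neg_inj] at this
  exact this

lemma norm_eq_one_of_map_y {L : Y →L[𝕜] Y} (hL : ∀ z, F.newNorm (L z) = F.newNorm z) {i : I}
    {a : 𝕜} (hi : L (F.y i) = a • F.y i) : ‖a‖ = 1 := by
  have h1 := hL (F.y i)
  have h2 : 0 < F.newNorm (F.y i) := by rw [newNorm_y]; linarith [F.w_pos i]
  rw [hi, map_smul_eq_mul] at h1
  exact mul_right_cancel₀ h2.ne' (by rw [h1, one_mul])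

lemma u_map {L : Y →L[𝕜] Y} (hL : ∀ z, F.newNorm (L z) = F.newNorm z) {i : I} {a : 𝕜}
    (hi : L (F.y i) = a • F.y i) (v : Y) : F.u i (L v) = a * F.u i v := by
  have ha := F.norm_eq_one_of_map_y hL hi
  have ha0 : a ≠ 0 := norm_ne_zero_iff.mp (by rw [ha]; exact one_ne_zero)
  have h1 := F.u_map_of_map_y_eq (L := a⁻¹ • L) (i := i)
    (fun z => by rw [smul_apply, map_smul_eq_mul, norm_inv, ha, hL]; simp)
    (by rw [smul_apply, hi, inv_smul_smul₀ ha0]) v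
  rw [← h1, smul_apply, map_smul, smul_eq_mul, mul_inv_cancel_left₀ ha0]

lemma injective_of_newNorm {L : Y →L[𝕜] Y} (hL : ∀ z, F.newNorm (L z) = F.newNorm z) :
    Function.Injective L := by
  refine (injective_iff_map_eq_zero L).mpr fun z hz => F.eq_zero_of_base_eq_zero ?_
  have h1 := F.scale_mul_base_le z
  rw [← hL, hz, map_zero] at h1
  have h2 : 0 ≤ F.base z := apply_nonneg _ _
  nlinarith [F.scale_pos]

/-- Every surjective isometry of the new norm acts on the frame as a unimodular scalar. -/
theorem exists_scalar_of_mem_isometryGroupOf [WellFoundedLT I] {L : Y →L[𝕜] Y}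
    (hL : L ∈ isometryGroupOf F.newNorm) :
    ∃ a : 𝕜, ‖a‖ = 1 ∧ (∀ i, L (F.y i) = a • F.y i) ∧ ∀ i z, F.u i (L z) = a * F.u i z := by
  have hC := F.one_le_bound
  have hinj := F.injective_of_newNorm hL.2
  have hpos : ∀ i, 0 < F.w i / (12 * F.bound) := fun i => by have := F.w_pos i; positivity
  obtain ⟨a, ha⟩ : ∃ a : 𝕜, L (F.y F.o) = a • F.y F.o := by
    have h1 := (F.isKink_y F.o).map hL
    obtain ⟨i, a, ha⟩ := F.exists_eq_smul_y_of_isKink (hpos F.o) h1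
    rw [ha] at h1
    rw [F.eq_o_of_isKink h1.of_smul] at ha
    exact ⟨a, ha⟩
  have hna := F.norm_eq_one_of_map_y hL.2 ha
  have ha0 : a ≠ 0 := norm_ne_zero_iff.mp (by rw [hna]; exact one_ne_zero)
  have hex : ∀ i, ∃ k, L (F.y i) = a • F.y k := fun i => by
    obtain ⟨k, b, hb⟩ := F.exists_eq_smul_y_of_isKink (hpos i) ((F.isKink_y i).map hL)
    by_cases hi : i = F.o
    · exact ⟨F.o, by rw [hi, ha]⟩
    · refine ⟨k, ?_⟩
      have hk : F.o ≠ k := by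
        rintro rfl
        have h1 : L (a • F.y i) = L (b • F.y F.o) := by
          rw [map_smul, map_smul, hb, ha, smul_comm]
        exact hi (F.eq_of_smul_y_eq_smul_y ha0 (hinj h1))
      -- `u o` takes one nonzero value at all apexes other than `y o`, so its invariance forces `b =
      -- a`.
      have h1 := F.u_map hL.2 ha (F.y i)
      rw [hb, map_smul, smul_eq_mul, F.u_y_of_ne hk, F.u_y_of_ne (Ne.symm hi),
        ← F.u_y_of_ne hk] at h1
      rw [hb, mul_right_cancel₀ (F.u_y_ne_zero _ _) h1]
  choose π hπ using hex
  have hπinj : Function.Injective π := fun i k hik => by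
    have h1 : L (F.y i) = L (F.y k) := by rw [hπ, hπ, hik]
    exact F.eq_of_smul_y_eq_smul_y (a := (1 : 𝕜)) (b := 1) one_ne_zero (by rw [hinj h1])
  have hmono : StrictMono π := fun i k hik => by
    rw [← F.three_lt_newNorm_iff (hπinj.ne hik.ne)]
    have h1 : a • (F.y (π i) + 2 • F.y (π k)) = L (F.y i + 2 • F.y k) := by
      rw [map_add, map_nsmul, hπ, hπ, smul_add, smul_comm]
    rw [← one_mul (F.newNorm _), ← hna, ← map_smul_eq_mul, h1, hL.2]
    exact (F.three_lt_newNorm_iff hik.ne).mpr hik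
  have hsurj : Function.Surjective π := fun k => by
    obtain ⟨z, hz⟩ := hL.1 (F.y k)
    have h1 := F.isKink_y k
    rw [← hz] at h1
    obtain ⟨i, b, rfl⟩ := F.exists_eq_smul_y_of_isKink (hpos k) (h1.of_map hL.2)
    rw [map_smul, hπ] at hz
    exact ⟨i, (F.eq_of_smul_y_eq_smul_y (a := (1 : 𝕜)) (b := b * a) one_ne_zero
      (by rw [one_smul, ← hz, mul_smul])).symm⟩
  -- Order isomorphisms of a well-order are unique.
  have hid : hmono.orderIsoOfSurjective π hsurj = OrderIso.refl I := Subsingleton.elim _ _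
  have hπid : ∀ i, π i = i := fun i => DFunLike.congr_fun hid i
  have hy : ∀ i, L (F.y i) = a • F.y i := fun i => by rw [hπ, hπid]
  exact ⟨a, hna, hy, fun i z => F.u_map hL.2 (hy i) z⟩

end WeightedFrame

/-! ### Operators in the reflexive hull and their surjectivity -/

/-- An injective operator that is a nonzero scalar on `E` and differs from this scalar, up to
finite-dimensional spaces, by an operator with range in `E`, is surjective. -/
lemma LinearMap.surjective_of_injective_of_scalar_mod_finiteDimensional {𝕜 V M : Type*} [Field 𝕜]
    [AddCommGroup V] [Module 𝕜 V] [AddCommGroup M] [Module 𝕜 M] [FiniteDimensional 𝕜 M]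
    {T : V →ₗ[𝕜] V} (hT : Function.Injective T) {a : 𝕜} (ha : a ≠ 0) {E E₀ : Submodule 𝕜 V}
    [FiniteDimensional 𝕜 E₀] (hE : ∀ z ∈ E, T z = a • z) (Φ : V →ₗ[𝕜] M)
    (hΦ : ∀ z, Φ z = 0 → T z - a • z ∈ E ⊔ E₀) : Function.Surjective T := by
  obtain ⟨E₂, hE₂⟩ := Submodule.exists_isCompl (LinearMap.ker Φ)
  have hfd : FiniteDimensional 𝕜 E₂ := by
    refine FiniteDimensional.of_injective (Φ.domRestrict E₂) ?_
    rw [← LinearMap.ker_eq_bot, LinearMap.ker_domRestrict, ← Submodule.disjoint_iff_comap_eq_bot]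
    exact hE₂.symm.disjoint
  set S : V →ₗ[𝕜] V := T - a • LinearMap.id with hS
  have hSapp : ∀ z, S z = T z - a • z := fun z => rfl
  have hS1 : ∀ z, S z ∈ E ⊔ (E₀ ⊔ E₂.map S) := fun z => by
    obtain ⟨z₁, h₁, z₂, h₂, rfl⟩ := Submodule.mem_sup.mp (hE₂.sup_eq_top ▸ Submodule.mem_top (x := z))
    rw [map_add, ← sup_assoc]
    exact add_mem (Submodule.mem_sup_left (hΦ z₁ h₁))
      (Submodule.mem_sup_right (Submodule.mem_map_of_mem h₂))
  have hcomap : E ≤ E.comap T := fun z hz => by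
    rw [Submodule.mem_comap, hE z hz]; exact E.smul_mem _ hz
  set Q := E.mapQ E T hcomap with hQ
  have hQinj : Function.Injective Q := by
    refine (injective_iff_map_eq_zero Q).mpr fun q hq => ?_
    obtain ⟨z, rfl⟩ := E.mkQ_surjective q
    rw [hQ, Submodule.mkQ_apply, Submodule.mapQ_apply, Submodule.Quotient.mk_eq_zero] at hq
    rw [Submodule.mkQ_apply, Submodule.Quotient.mk_eq_zero]
    have : z = a⁻¹ • T z := hT (by rw [map_smul, hE _ hq, inv_smul_smul₀ ha])
    rw [this]
    exact E.smul_mem _ hq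
  -- `G` is finite-dimensional and contains the range of `Q - a`. Thus `Q` preserves `G`, is onto it
  -- by injectivity, and `a • q` is always in the range of `Q`.
  set G := (E₀ ⊔ E₂.map S).map E.mkQ with hG
  have hSG : ∀ q, Q q - a • q ∈ G := fun q => by
    obtain ⟨z, rfl⟩ := E.mkQ_surjective q
    obtain ⟨z₁, h₁, z₂, h₂, h⟩ := Submodule.mem_sup.mp (hS1 z)
    refine ⟨z₂, h₂, ?_⟩
    have h3 : E.mkQ z₁ = 0 := by simpa using h₁
    have h4 : Q (E.mkQ z) = E.mkQ (T z) := rfl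
    rw [h4, ← map_smul, ← map_sub, ← hSapp, ← h, map_add, h3, zero_add]
  have hQG : ∀ q ∈ G, Q q ∈ G := fun q hq => by
    have := add_mem (hSG q) (G.smul_mem a hq)
    rwa [sub_add_cancel] at this
  have hsurjG : Function.Surjective (Q.restrict hQG) := by
    rw [← LinearMap.injective_iff_surjective]
    exact fun q r h => Subtype.ext (hQinj (congrArg Subtype.val h))
  have hQsurj : Function.Surjective Q := fun q => by
    obtain ⟨r, hr⟩ := hsurjG ⟨_, hSG q⟩
    have hr' : Q r = Q q - a • q := congrArg Subtype.val hr
    refine ⟨a⁻¹ • (q - r), ?_⟩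
    rw [map_smul, map_sub, hr', sub_sub_cancel, inv_smul_smul₀ ha]
  intro z
  obtain ⟨q, hq⟩ := hQsurj (E.mkQ z)
  obtain ⟨v, rfl⟩ := E.mkQ_surjective q
  have h4 : Q (E.mkQ v) = E.mkQ (T v) := rfl
  rw [h4, ← sub_eq_zero, ← map_sub] at hq
  have h5 : T v - z ∈ E := by rwa [Submodule.mkQ_apply, Submodule.Quotient.mk_eq_zero] at hq
  refine ⟨v - a⁻¹ • (T v - z), ?_⟩
  rw [map_sub, hE _ (E.smul_mem _ h5), smul_inv_smul₀ ha, sub_sub_cancel]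

lemma Seminorm.continuous_of_isEquivalentNorm {𝕜 Y : Type*} [RCLike 𝕜] [NormedAddCommGroup Y]
    [NormedSpace 𝕜 Y] {p : Seminorm 𝕜 Y} (hp : IsEquivalentNorm p) : Continuous p := by
  obtain ⟨c, C, -, hC, h⟩ := hp
  refine Seminorm.continuous_of_le (q := C.toNNReal • normSeminorm 𝕜 Y) ?_ fun x => ?_
  · exact continuous_norm.const_smul C.toNNReal
  · calc p x ≤ C * ‖x‖ := (h x).2
      _ = (C.toNNReal : ℝ) * ‖x‖ := by rw [Real.coe_toNNReal C hC.le]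

/-- Operators in the reflexive hull of the isometry group are isometric. -/
lemma apply_eq_of_mem_topReflexiveHull {𝕜 Y : Type*} [RCLike 𝕜] [NormedAddCommGroup Y]
    [NormedSpace 𝕜 Y] {p : Seminorm 𝕜 Y} (hp : IsEquivalentNorm p) {T : Y →L[𝕜] Y}
    (hT : T ∈ topReflexiveHull (isometryGroupOf p)) (z : Y) : p (T z) = p z := by
  have hc : IsClosed {v | p v = p z} :=
    isClosed_eq (Seminorm.continuous_of_isEquivalentNorm hp) continuous_const
  refine closure_minimal ?_ hc (hT z)
  rintro _ ⟨L, hL, rfl⟩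
  exact hL.2 z

lemma subset_topReflexiveHull {𝕜 Y : Type*} [RCLike 𝕜] [NormedAddCommGroup Y] [NormedSpace 𝕜 Y]
    (S : Set (Y →L[𝕜] Y)) : S ⊆ topReflexiveHull S :=
  fun L hL _ => subset_closure ⟨L, hL, rfl⟩

/-- If every operator in `S` has `z` as an eigenvector with unimodular eigenvalue, then so has every
operator in the reflexive hull of `S`. -/
lemma exists_eigenvalue_of_mem_topReflexiveHull {𝕜 Y : Type*} [RCLike 𝕜] [NormedAddCommGroup Y]
    [NormedSpace 𝕜 Y] {S : Set (Y →L[𝕜] Y)} {T : Y →L[𝕜] Y} (hT : T ∈ topReflexiveHull S) {z : Y}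
    (h : ∀ L ∈ S, ∃ a : 𝕜, ‖a‖ = 1 ∧ L z = a • z) : ∃ a : 𝕜, ‖a‖ = 1 ∧ T z = a • z := by
  have hc : IsClosed ((fun a : 𝕜 => a • z) '' Metric.sphere 0 1) :=
    ((isCompact_sphere (0 : 𝕜) 1).image (by fun_prop)).isClosed
  have : T z ∈ (fun a : 𝕜 => a • z) '' Metric.sphere 0 1 := by
    refine closure_minimal ?_ hc (hT z)
    rintro _ ⟨L, hL, rfl⟩
    obtain ⟨a, ha, h⟩ := h L hL
    exact ⟨a, by simpa using ha, h.symm⟩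
  obtain ⟨a, ha, h⟩ := this
  exact ⟨a, by simpa using ha, h.symm⟩

namespace WeightedFrame

variable {𝕜 Y I : Type*} [RCLike 𝕜] [NormedAddCommGroup Y] [NormedSpace 𝕜 Y]
variable (F : WeightedFrame 𝕜 Y I) [LinearOrder I] [WellFoundedLT I]

lemma exists_scalar_of_mem_topReflexiveHull {T : Y →L[𝕜] Y}
    (hT : T ∈ topReflexiveHull (isometryGroupOf F.newNorm)) :
    ∃ a : 𝕜, a ≠ 0 ∧ (∀ i, T (F.y i) = a • F.y i) ∧ ∀ i z, F.u i (T z) = a * F.u i z := by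
  have hy : ∀ i, ∃ a : 𝕜, ‖a‖ = 1 ∧ T (F.y i) = a • F.y i := fun i =>
    exists_eigenvalue_of_mem_topReflexiveHull hT fun L hL => by
      obtain ⟨a, ha, h, -⟩ := F.exists_scalar_of_mem_isometryGroupOf hL
      exact ⟨a, ha, h i⟩
  obtain ⟨a, ha, hao⟩ := hy F.o
  have hya : ∀ i, T (F.y i) = a • F.y i := fun i => by
    by_cases hi : i = F.o
    · rw [hi, hao]
    obtain ⟨b, -, hb⟩ := hy i
    -- The hull yields an eigenvalue for each vector separately; the common eigenvector `y o + y i`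
    -- equates those of `y o` and `y i`.
    obtain ⟨c, -, hc⟩ := exists_eigenvalue_of_mem_topReflexiveHull hT (z := F.y F.o + F.y i)
      fun L hL => by
        obtain ⟨a, ha, h, -⟩ := F.exists_scalar_of_mem_isometryGroupOf hL
        exact ⟨a, ha, by rw [map_add, h, h, smul_add]⟩
    rw [map_add, hao, hb] at hc
    have h1 := congrArg (F.f i) hc
    have h2 := congrArg (F.f F.o) hc
    simp only [map_add, map_smul, F.f_y, F.f_y_of_ne hi, F.f_y_of_ne (Ne.symm hi), smul_eq_mul,
      mul_one, mul_zero, zero_add, add_zero] at h1 h2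
    rw [hb, h1, h2]
  refine ⟨a, norm_ne_zero_iff.mp (by rw [ha]; exact one_ne_zero), hya, fun i z => ?_⟩
  -- The scalar depends on `L`, so only the kernel of `u i` passes to the closure directly; the
  -- value at `y i` then gives the factor.
  have hker : ∀ z, F.u i z = 0 → F.u i (T z) = 0 := fun z hz => by
    refine closure_minimal (t := {v | F.u i v = 0}) ?_
      (isClosed_eq (F.u i).continuous continuous_const) (hT z)
    rintro _ ⟨L, hL, rfl⟩
    obtain ⟨a, -, -, h⟩ := F.exists_scalar_of_mem_isometryGroupOf hL
    simp [h, hz]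
  have h0 := F.u_y_ne_zero i i
  have h1 := hker (z - (F.u i z / F.u i (F.y i)) • F.y i) (by simp [h0])
  rw [map_sub, map_sub, map_smul, map_smul, hya, map_smul, smul_eq_mul, smul_eq_mul,
    sub_eq_zero] at h1
  rw [h1]; field_simp

/-- If the frame is maximal, then the isometry group of the new norm is topologically reflexive. -/
theorem isTopologicallyReflexive_newNorm
    (hmax : ∀ z, F.f₀ z = 0 → F.g z = 0 → (∀ i, F.f i z = 0) →
      z ∈ closure (Submodule.span 𝕜 (insert F.e (range F.x)) ⊔
        LinearMap.range F.j.toLinearMap : Submodule 𝕜 Y)) :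
    IsTopologicallyReflexive (isometryGroupOf F.newNorm) := by
  refine Subset.antisymm (fun T hT => ?_) (subset_topReflexiveHull _)
  have hiso := apply_eq_of_mem_topReflexiveHull F.isEquivalentNorm_newNorm hT
  obtain ⟨a, ha, hy, hu⟩ := F.exists_scalar_of_mem_topReflexiveHull hT
  refine ⟨?_, hiso⟩
  set E := (Submodule.span 𝕜 (range F.y)).topologicalClosure
  set E₀ : Submodule 𝕜 Y := Submodule.span 𝕜 {F.e} ⊔ LinearMap.range F.j.toLinearMap
  have hEcl : IsClosed ((E ⊔ E₀ : Submodule 𝕜 Y) : Set Y) :=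
    Submodule.isClosed_sup_finiteDimensional _ _ (Submodule.isClosed_topologicalClosure _)
  have he : F.e ∈ E ⊔ E₀ :=
    Submodule.mem_sup_right (Submodule.mem_sup_left (Submodule.mem_span_singleton_self _))
  have hle : Submodule.span 𝕜 (insert F.e (range F.x)) ⊔ LinearMap.range F.j.toLinearMap ≤
      E ⊔ E₀ := by
    refine sup_le (Submodule.span_le.mpr (insert_subset he ?_)) (le_sup_right.trans le_sup_right)
    rintro _ ⟨i, rfl⟩
    have h1 : F.y i ∈ E ⊔ E₀ := Submodule.mem_sup_left
      (Submodule.le_topologicalClosure _ (Submodule.subset_span (mem_range_self i)))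
    have h2 := sub_mem h1 he
    rwa [y, add_sub_cancel_left] at h2
  have hE : ∀ z ∈ E, T.toLinearMap z = a • z := fun z hz => by
    refine closure_minimal (t := {v | T v = a • v}) ?_
      (isClosed_eq T.continuous (continuous_const_smul a)) hz
    have : Submodule.span 𝕜 (range F.y) ≤ LinearMap.eqLocus T.toLinearMap (a • LinearMap.id) := by
      rw [Submodule.span_le]
      rintro _ ⟨i, rfl⟩
      exact hy i
    exact this
  -- On the kernel of `Φ`, `T z - a • z` is killed by `f₀` and `g`; being killed by `u i` too, it is
  -- killed by every `f i`, and maximality applies.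
  let Φ : Y →ₗ[𝕜] 𝕜 × EuclideanSpace 𝕜 (Fin 2) :=
    (F.f₀.toLinearMap.prod F.g.toLinearMap).comp (T.toLinearMap - a • LinearMap.id)
  refine LinearMap.surjective_of_injective_of_scalar_mod_finiteDimensional (T := T.toLinearMap)
    (F.injective_of_newNorm hiso) ha hE (E₀ := E₀) Φ fun z hz => ?_
  have hz' : F.f₀ (T z - a • z) = 0 ∧ F.g (T z - a • z) = 0 := by simpa [Φ] using hz
  refine closure_minimal hle hEcl (hmax (T z - a • z) hz'.1 hz'.2 fun i => ?_)
  have h1 : F.u i (T z - a • z) = 0 := by rw [map_sub, hu, map_smul, smul_eq_mul, sub_self]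
  have hw : (F.w i : 𝕜) ≠ 0 := RCLike.ofReal_ne_zero.mpr (F.w_pos i).ne'
  have h2 : F.u i (T z - a • z) = F.f₀ (T z - a • z) + (F.w i : 𝕜) *
    (F.f i (T z - a • z) - ((3 / 4 : ℝ) : 𝕜) * F.f₀ (T z - a • z)) := rfl
  rw [h2, hz'.1, mul_zero, sub_zero, zero_add] at h1
  exact (mul_eq_zero.mp h1).resolve_left hw

end WeightedFrame

/-! ### Maximal biorthogonal systems and the frame -/

section Biorthogonal

variable {𝕜 Y : Type*} [RCLike 𝕜] [NormedAddCommGroup Y] [NormedSpace 𝕜 Y]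

/-- A set of pairs of vectors and functionals is a biorthogonal system with unit vectors. -/
def IsBiorthogonal (S : Set (Y × (Y →L[𝕜] 𝕜))) : Prop :=
  (∀ q ∈ S, ‖q.1‖ = 1 ∧ q.2 q.1 = 1) ∧ ∀ q ∈ S, ∀ r ∈ S, q ≠ r → q.2 r.1 = 0

lemma exists_maximal_isBiorthogonal :
    ∃ S : Set (Y × (Y →L[𝕜] 𝕜)), Maximal IsBiorthogonal S := by
  refine zorn_subset {S | IsBiorthogonal S} fun c hc hchain =>
    ⟨⋃₀ c, ⟨?_, ?_⟩, fun s hs => subset_sUnion_of_mem hs⟩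
  · rintro q ⟨s, hs, hq⟩
    exact (hc hs).1 q hq
  · rintro q ⟨s, hs, hq⟩ r ⟨t, ht, hr⟩ hqr
    obtain ⟨v, hv, hsv, htv⟩ := hchain.directedOn s hs t ht
    exact (hc hv).2 q (hsv hq) r (htv hr) hqr

/-- Hahn–Banach in the quotient by `E`. -/
lemma exists_functional_eq_one_of_notMem {E : Submodule 𝕜 Y} (hE : IsClosed (E : Set Y)) {z : Y}
    (hz : z ∉ E) : ∃ φ : Y →L[𝕜] 𝕜, φ z = 1 ∧ ∀ v ∈ E, φ v = 0 := by
  have : E.mkQ z ≠ 0 := by simpa using hz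
  obtain ⟨φ, hφ⟩ := SeparatingDual.exists_eq_one (R := 𝕜) this
  refine ⟨φ.comp E.mkQL, hφ, fun v hv => ?_⟩
  have : E.mkQ v = 0 := by simpa using hv
  change φ (E.mkQ v) = 0
  rw [this, map_zero]

/-- The common kernel of the functionals of a maximal biorthogonal system is contained in the closed
span of its vectors. -/
lemma Maximal.mem_closure_span {S : Set (Y × (Y →L[𝕜] 𝕜))} (hS : Maximal IsBiorthogonal S) {z : Y}
    (hz : ∀ q ∈ S, q.2 z = 0) : z ∈ closure (Submodule.span 𝕜 (Prod.fst '' S) : Set Y) := by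
  by_contra hcon
  obtain ⟨φ, hφ, hφ0⟩ := exists_functional_eq_one_of_notMem
    (E := (Submodule.span 𝕜 (Prod.fst '' S)).topologicalClosure)
    (Submodule.isClosed_topologicalClosure _) hcon
  have hφS : ∀ q ∈ S, φ q.1 = 0 := fun q hq =>
    hφ0 _ (Submodule.le_topologicalClosure _ (Submodule.subset_span (mem_image_of_mem _ hq)))
  have hz0 : ‖z‖ ≠ 0 := by
    rw [norm_ne_zero_iff]
    rintro rfl
    rw [map_zero] at hφ
    exact zero_ne_one hφ
  have hz0' : ((‖z‖ : ℝ) : 𝕜) ≠ 0 := RCLike.ofReal_ne_zero.mpr hz0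
  -- The normalized pair could be adjoined to `S`; by maximality it already lies in `S`, yet `φ`
  -- kills the vectors of `S`.
  set q₀ : Y × (Y →L[𝕜] 𝕜) := (((‖z‖ : ℝ) : 𝕜)⁻¹ • z, ((‖z‖ : ℝ) : 𝕜) • φ)
  have hins : IsBiorthogonal (insert q₀ S) := by
    refine ⟨?_, ?_⟩
    · rintro q (rfl | hq)
      · refine ⟨?_, ?_⟩
        · change ‖((‖z‖ : ℝ) : 𝕜)⁻¹ • z‖ = 1
          rw [norm_smul, norm_inv, RCLike.norm_ofReal, abs_norm, inv_mul_cancel₀ hz0]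
        · change ((‖z‖ : ℝ) : 𝕜) • φ (((‖z‖ : ℝ) : 𝕜)⁻¹ • z) = 1
          rw [map_smul, smul_inv_smul₀ hz0', hφ]
      · exact hS.prop.1 q hq
    · rintro q (rfl | hq) r (rfl | hr) hqr
      · exact absurd rfl hqr
      · change ((‖z‖ : ℝ) : 𝕜) • φ r.1 = 0
        rw [hφS r hr, smul_zero]
      · change q.2 (((‖z‖ : ℝ) : 𝕜)⁻¹ • z) = 0
        rw [map_smul, hz q hq, smul_zero]
      · exact hS.prop.2 q hq r hr hqr
  have hmem : q₀ ∈ S := hS.le_of_ge hins (subset_insert _ _) (mem_insert _ _)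
  have h1 := (hS.prop.1 q₀ hmem).2
  have h2 : q₀.2 q₀.1 = ((‖z‖ : ℝ) : 𝕜) * φ q₀.1 := rfl
  rw [h2, hφS _ hmem, mul_zero] at h1
  exact zero_ne_one h1

/-- For a finite system, `z` minus its biorthogonal expansion is killed by all functionals, so the
span, closed by finite dimension, is everything. -/
lemma Maximal.infinite_of_not_finiteDimensional {S : Set (Y × (Y →L[𝕜] 𝕜))}
    (hS : Maximal IsBiorthogonal S) (hY : ¬ FiniteDimensional 𝕜 Y) : S.Infinite := by
  intro hfin
  have hfd : FiniteDimensional 𝕜 (Submodule.span 𝕜 (Prod.fst '' S)) :=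
    FiniteDimensional.span_of_finite 𝕜 (hfin.image _)
  have hcl : IsClosed (Submodule.span 𝕜 (Prod.fst '' S) : Set Y) :=
    Submodule.closed_of_finiteDimensional _
  refine hY (Module.finite_def.mpr ?_)
  suffices Submodule.span 𝕜 (Prod.fst '' S) = ⊤ from ⟨(hfin.image _).toFinset, by simpa⟩
  refine Submodule.eq_top_iff'.mpr fun z => ?_
  have hmem : ∑ q ∈ hfin.toFinset, q.2 z • q.1 ∈ Submodule.span 𝕜 (Prod.fst '' S) :=
    Submodule.sum_mem _ fun q hq => Submodule.smul_mem _ _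
      (Submodule.subset_span (mem_image_of_mem _ (hfin.mem_toFinset.mp hq)))
  have h1 := hS.mem_closure_span (z := z - ∑ q ∈ hfin.toFinset, q.2 z • q.1) fun r hr => by
    rw [map_sub, map_sum, Finset.sum_eq_single_of_mem r (hfin.mem_toFinset.mpr hr)]
    · rw [map_smul, (hS.prop.1 r hr).2, smul_eq_mul, mul_one, sub_self]
    · intro q hq hqr
      rw [map_smul, hS.prop.2 r hr q (hfin.mem_toFinset.mp hq) hqr.symm, smul_zero]
  rw [hcl.closure_eq] at h1
  simpa using add_mem h1 hmem

/-- In an infinite-dimensional space there is a weighted frame that is maximal. -/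
lemma exists_maximal_weightedFrame (hY : ¬ FiniteDimensional 𝕜 Y) :
    ∃ (I : Set (Y × (Y →L[𝕜] 𝕜))) (F : WeightedFrame 𝕜 Y I),
      ∀ z, F.f₀ z = 0 → F.g z = 0 → (∀ i, F.f i z = 0) →
        z ∈ closure (Submodule.span 𝕜 (insert F.e (range F.x)) ⊔
          LinearMap.range F.j.toLinearMap : Submodule 𝕜 Y) := by
  obtain ⟨S, hS⟩ := exists_maximal_isBiorthogonal (𝕜 := 𝕜) (Y := Y)
  obtain ⟨hS1, hS2⟩ := hS.prop
  have hinf := hS.infinite_of_not_finiteDimensional hY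
  set q : ℕ → Y × (Y →L[𝕜] 𝕜) := fun n => hinf.natEmbedding S n with hq
  have hqS : ∀ n, q n ∈ S := fun n => (hinf.natEmbedding S n).2
  have hqne : ∀ {m n}, m ≠ n → q m ≠ q n := fun hmn h =>
    hmn ((hinf.natEmbedding S).injective (Subtype.ext h))
  have hqq : ∀ {m n}, m ≠ n → (q m).2 (q n).1 = 0 := fun hmn =>
    hS2 _ (hqS _) _ (hqS _) (hqne hmn)
  -- `q 0` becomes `(e, f₀)`, `q 1` and `q 2` span the block, and `q 3` serves as `o`.
  set I : Set (Y × (Y →L[𝕜] 𝕜)) := S \ {q 0, q 1, q 2} with hI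
  have hIne : ∀ (i : I) {n : ℕ}, n < 3 → i.1 ≠ q n := fun i n hn h => by
    refine i.2.2 ?_
    rw [h]
    interval_cases n <;> simp
  have hIq : ∀ (i : I) {n : ℕ}, n < 3 → i.1.2 (q n).1 = 0 := fun i n hn =>
    hS2 _ i.2.1 _ (hqS _) (hIne i hn)
  have hqI : ∀ (i : I) {n : ℕ}, n < 3 → (q n).2 i.1.1 = 0 := fun i n hn =>
    hS2 _ (hqS _) _ i.2.1 (hIne i hn).symm
  let o : I := ⟨q 3, hqS 3, by
    simp [hqne (show 3 ≠ 0 by decide), hqne (show 3 ≠ 1 by decide), hqne (show 3 ≠ 2 by decide)]⟩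
  let j : EuclideanSpace 𝕜 (Fin 2) →L[𝕜] Y :=
    (EuclideanSpace.proj 0).smulRight (q 1).1 + (EuclideanSpace.proj 1).smulRight (q 2).1
  let g : Y →L[𝕜] EuclideanSpace 𝕜 (Fin 2) :=
    (EuclideanSpace.equiv (Fin 2) 𝕜).symm.toContinuousLinearMap.comp
      (ContinuousLinearMap.pi ![(q 1).2, (q 2).2])
  have hj : ∀ a, j a = a 0 • (q 1).1 + a 1 • (q 2).1 := fun a => rfl
  have hg0 : ∀ z, g z 0 = (q 1).2 z := fun z => rfl
  have hg1 : ∀ z, g z 1 = (q 2).2 z := fun z => rfl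
  have hg : ∀ {z}, (q 1).2 z = 0 → (q 2).2 z = 0 → g z = 0 := fun {z} h1 h2 => by
    ext k; fin_cases k
    exacts [h1, h2]
  set K : ℝ := (2 + ‖(q 0).2‖ * (‖(q 0).1‖ + 2)) * (1 + ‖(q 0).1‖) with hK
  have hK1 : 1 ≤ K := by
    rw [hK]
    nlinarith [norm_nonneg (q 0).1, norm_nonneg (q 0).2,
      mul_nonneg (norm_nonneg (q 0).2) (norm_nonneg (q 0).1),
      mul_nonneg (mul_nonneg (norm_nonneg (q 0).2) (norm_nonneg (q 0).1)) (norm_nonneg (q 0).1)]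
  classical
  set b : ℝ := (1 + ‖(q 3).2‖)⁻¹ with hb
  have hb0 : 0 < b := by positivity
  have hb1 : b ≤ 1 := inv_le_one_of_one_le₀ (by linarith [norm_nonneg (q 3).2])
  -- Dividing by `1 + ‖f i‖` gives `w_mul_le`; the factor `2 * K` makes `w o` dominate strictly.
  let w : I → ℝ := fun i => if i = o then b else b / (2 * K * (1 + ‖i.1.2‖))
  let F : WeightedFrame 𝕜 Y I :=
    { e := (q 0).1
      f₀ := (q 0).2
      x := fun i => i.1.1
      f := fun i => i.1.2
      j := j
      g := g
      w := w
      o := o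
      f₀_e := (hS1 _ (hqS 0)).2
      f₀_x := fun i => hqI i (by norm_num)
      f₀_j := fun a => by
        rw [hj, map_add, map_smul, map_smul, hqq (by decide), hqq (by decide)]; simp
      f_e := fun i => hIq i (by norm_num)
      f_x := fun i => (hS1 _ i.2.1).2
      f_x_of_ne := fun {i k} h => hS2 _ i.2.1 _ k.2.1 fun h' => h (Subtype.ext h')
      f_j := fun i a => by
        rw [hj, map_add, map_smul, map_smul, hIq i (by norm_num), hIq i (by norm_num)]; simp
      g_e := hg (hqq (by decide)) (hqq (by decide))
      g_x := fun i => hg (hqI i (by norm_num)) (hqI i (by norm_num))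
      g_j := fun a => by
        ext k; fin_cases k
        · change (q 1).2 (j a) = a 0
          rw [hj, map_add, map_smul, map_smul, hqq (show 1 ≠ 2 by decide), (hS1 _ (hqS 1)).2]; simp
        · change (q 2).2 (j a) = a 1
          rw [hj, map_add, map_smul, map_smul, hqq (show 2 ≠ 1 by decide), (hS1 _ (hqS 2)).2]; simp
      norm_x := fun i => (hS1 _ i.2.1).1
      w_pos := fun i => by
        change 0 < ite _ _ _
        split_ifs <;> positivity
      w_mul_le := fun i => by
        change ite _ _ _ * _ ≤ _
        split_ifs with h
        · rw [h, hb]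
          exact (inv_mul_cancel₀ (by positivity)).le
        · have : b / (2 * K * (1 + ‖i.1.2‖)) * (1 + ‖i.1.2‖) = b / (2 * K) := by field_simp
          rw [this, div_le_one (by positivity)]
          linarith
      w_mul_lt := fun i hi => by
        change ite _ _ _ * K < ite _ _ _
        rw [if_neg hi, if_pos rfl]
        have : b / (2 * K * (1 + ‖i.1.2‖)) * K = b / (2 * (1 + ‖i.1.2‖)) := by field_simp
        rw [this]
        exact div_lt_self hb0 (by linarith [norm_nonneg i.1.2]) }
  refine ⟨I, F, fun z h0 hgz hf => ?_⟩
  have hle : Submodule.span 𝕜 (Prod.fst '' S) ≤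
      Submodule.span 𝕜 (insert F.e (range F.x)) ⊔ LinearMap.range F.j.toLinearMap := by
    rw [Submodule.span_le]
    rintro _ ⟨r, hr, rfl⟩
    by_cases hrI : r ∈ ({q 0, q 1, q 2} : Set (Y × (Y →L[𝕜] 𝕜)))
    · rcases hrI with rfl | rfl | rfl
      · exact Submodule.mem_sup_left (Submodule.subset_span (mem_insert _ _))
      · refine Submodule.mem_sup_right ⟨EuclideanSpace.single 0 1, ?_⟩
        change j _ = _
        rw [hj]; simp
      · refine Submodule.mem_sup_right ⟨EuclideanSpace.single 1 1, ?_⟩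
        change j _ = _
        rw [hj]; simp
    · exact Submodule.mem_sup_left
        (Submodule.subset_span (mem_insert_of_mem _ ⟨⟨r, hr, hrI⟩, rfl⟩))
  refine closure_mono hle (hS.mem_closure_span fun r hr => ?_)
  by_cases hrI : r ∈ ({q 0, q 1, q 2} : Set (Y × (Y →L[𝕜] 𝕜)))
  · rcases hrI with rfl | rfl | rfl
    · exact h0
    · rw [← hg0]; change F.g z 0 = 0; rw [hgz]; rfl
    · rw [← hg1]; change F.g z 1 = 0; rw [hgz]; rfl
  · exact hf ⟨r, hr, hrI⟩

end Biorthogonal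

/-! ### The finite-dimensional case and the conclusion -/

lemma isTopologicallyReflexive_of_finiteDimensional {𝕜 Y : Type*} [RCLike 𝕜]
    [NormedAddCommGroup Y] [NormedSpace 𝕜 Y] [FiniteDimensional 𝕜 Y] {p : Seminorm 𝕜 Y}
    (hp : IsEquivalentNorm p) : IsTopologicallyReflexive (isometryGroupOf p) := by
  refine Subset.antisymm (fun T hT => ?_) (subset_topReflexiveHull _)
  have hiso := apply_eq_of_mem_topReflexiveHull hp hT
  refine ⟨?_, hiso⟩
  have hinj : Function.Injective T.toLinearMap := by
    refine (injective_iff_map_eq_zero T.toLinearMap).mpr fun z hz => ?_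
    obtain ⟨c, C, hc, -, h⟩ := hp
    have h1 := hiso z
    have h2 : T z = 0 := hz
    rw [h2, map_zero] at h1
    have h3 := (h z).1
    rw [← h1] at h3
    exact norm_le_zero_iff.mp (nonpos_of_mul_nonpos_right h3 hc)
  exact LinearMap.injective_iff_surjective.mp hinj

theorem mainTheorem10 {𝕜 : Type*} [RCLike 𝕜] {Y : Type*} [NormedAddCommGroup Y]
    [NormedSpace 𝕜 Y] [CompleteSpace Y] :
    ∃ p : Seminorm 𝕜 Y, IsEquivalentNorm p ∧ IsTopologicallyReflexive (isometryGroupOf p) := by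
  by_cases hY : FiniteDimensional 𝕜 Y
  · have hp : IsEquivalentNorm (normSeminorm 𝕜 Y) :=
      ⟨1, 1, one_pos, one_pos, fun x => by simp⟩
    exact ⟨_, hp, isTopologicallyReflexive_of_finiteDimensional hp⟩
  · obtain ⟨I, F, hF⟩ := exists_maximal_weightedFrame hY
    -- The order on `I` comes from the well-ordering theorem; the frame does not involve it.
    obtain ⟨_, _⟩ := exists_wellFoundedLT I
    exact ⟨F.newNorm, F.isEquivalentNorm_newNorm, F.isTopologicallyReflexive_newNorm hF⟩
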